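/- There are absolute constants $c_0 > 0$ and $\gamma > 0$ such that the following holds for all integers $n \ge 1$ and $m \ge 0$ with $m \ge c_0\, n \log n$, in each of two models: the real model, where $\mathbb{K} = \mathbb{R}$, and the complex model, where $\mathbb{K} = \mathbb{C}$. Let $x \in \mathbb{K}^n$ be an arbitrary fixed vector, let $z_1, \dots, z_m$ be independent random vectors, each uniformly distributed on the unit sphere $\{z \in \mathbb{K}^n : \|z\|_2 = 1\}$, and put $b_i = |\langle x, z_i\rangle|^2$ for $i = 1, \dots, m$. Consider the trace-minimization program over Hermitian matrices $X \in \mathbb{K}^{n\times n}$ (symmetric matrices if $\mathbb{K} = \mathbb{R}$) $$\text{minimize } \operatorname{Tr}(X) \quad \text{subject to} \quad z_i^* X z_i = b_i \ (i = 1, \dots, m), \quad X \succeq 0.$$ Then, with probability at least $1 - 3 e^{-\gamma m/n}$, the matrix $x x^*$ is a solution of this program and it is the only one. -/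

import Mathlib

open MeasureTheory ProbabilityTheory
open scoped ComplexOrder

namespace PhaseLift

section Sphere

variable (E : Type*) [NormedAddCommGroup E] [InnerProductSpace ℝ E] [FiniteDimensional ℝ E]
  [MeasurableSpace E] [BorelSpace E]

/-- The uniform distribution on the unit sphere of `E`: the surface measure induced by Lebesgue
measure, divided by its total mass. It is a probability measure as soon as `E` is nontrivial. -/
noncomputable def uniformSphere : Measure (Metric.sphere (0 : E) 1) :=
  ((volume : Measure E).toSphere Set.univ)⁻¹ • (volume : Measure E).toSphere

end Sphere

section Program

variable {𝕜 : Type*} [RCLike 𝕜] {n m : ℕ}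

/-- The map `X ↦ (zᵢ* X zᵢ)ᵢ`. For a Hermitian matrix `X` the numbers `zᵢ* X zᵢ` are real, so
that taking the real part only changes the type; the map is only used for such `X`. -/
noncomputable def measurementMap (z : Fin m → EuclideanSpace 𝕜 (Fin n))
    (X : Matrix (Fin n) (Fin n) 𝕜) : Fin m → ℝ :=
  fun i => RCLike.re (star (z i).ofLp ⬝ᵥ (X.mulVec (z i).ofLp))

/-- The intensity measurements `bᵢ = |⟨x, zᵢ⟩|²`. -/
noncomputable def intensities (z : Fin m → EuclideanSpace 𝕜 (Fin n))
    (x : EuclideanSpace 𝕜 (Fin n)) : Fin m → ℝ :=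
  fun i => ‖inner 𝕜 x (z i)‖ ^ 2

/-- The rank-one lift `x x*`. -/
def lift (x : EuclideanSpace 𝕜 (Fin n)) : Matrix (Fin n) (Fin n) 𝕜 :=
  Matrix.vecMulVec x.ofLp (star x.ofLp)

/-- `X` is feasible: `𝒜(X) = b` and `X ⪰ 0` (which includes that `X` is Hermitian, that is,
symmetric when `𝕜 = ℝ`). -/
def Feasible (z : Fin m → EuclideanSpace 𝕜 (Fin n)) (b : Fin m → ℝ)
    (X : Matrix (Fin n) (Fin n) 𝕜) : Prop :=
  measurementMap z X = b ∧ X.PosSemidef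

/-- `X` solves: minimize `Tr X` subject to `𝒜(X) = b` and `X ⪰ 0`. The trace of a feasible matrix
is real. -/
def IsSolution (z : Fin m → EuclideanSpace 𝕜 (Fin n)) (b : Fin m → ℝ)
    (X : Matrix (Fin n) (Fin n) 𝕜) : Prop :=
  Feasible z b X ∧ ∀ X', Feasible z b X' → RCLike.re X.trace ≤ RCLike.re X'.trace

/-- `x x*` is a solution of the trace-minimization program with data `bᵢ = |⟨x, zᵢ⟩|²`, and it is
the only one. -/
def ExactRecovery (z : Fin m → EuclideanSpace 𝕜 (Fin n)) (x : EuclideanSpace 𝕜 (Fin n)) : Prop :=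
  ∀ X : Matrix (Fin n) (Fin n) 𝕜, IsSolution z (intensities z x) X ↔ X = lift x

end Program

end PhaseLift

/-! The trace plays no role: with the stated probability `lift x` is the only feasible matrix. Write
x = ‖x‖e with e a unit vector. A feasible X factors as ∑ yₖyₖ*, and splitting each yₖ along e gives
X − xx* = eh* + he* + ∑ cₖcₖ* with all cₖ orthogonal to e (`sum_norm_inner_sq_sub`). All
measurements of this difference vanish, and the task is to deduce h = 0 and cₖ = 0.

Two comparisons between ‖h‖ and T = ∑ ‖cₖ‖² achieve this
(`IsGoodSample.eq_zero_of_measurements_eq_zero`). Weighting measurement i by a constant minus the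
truncated intensity of zᵢ along e gives an approximate dual certificate: on average it kills the
tangent part eh* + he* and charges at least 1/3 per unit of T, so T ≤ 16ε‖h‖. Conversely, the
tangent measurements have mean modulus at least of order ‖h‖, yet they are opposite to those of ∑
cₖcₖ*, whose mean is at most (1 + 2ε)T. For small ε both parts vanish.

The expectations come from second and fourth moments on the sphere. Truncation at an absolute level
keeps the weighted intensities subexponential, so a Chernoff bound gives failure probability e^{-cm}
in one direction. A union bound over a grid with e^{O(n log n)} points makes this uniform, which is
where m ≥ c₀ n log n is needed. -/

namespace PhaseLift

/-! ### Rotation invariance and low moments of the uniform law on the sphere -/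

section SphereLaw

open Metric Set
open scoped Pointwise ENNReal

variable (E : Type*) [NormedAddCommGroup E] [InnerProductSpace ℝ E] [FiniteDimensional ℝ E]
  [MeasurableSpace E] [BorelSpace E]

/-- The uniform distribution on the unit sphere, as a measure on the ambient space. -/
noncomputable def sphereLaw : Measure E := (uniformSphere E).map Subtype.val

theorem toSphere_univ_ne_zero [Nontrivial E] : (volume : Measure E).toSphere univ ≠ 0 := by
  rw [Ne, Measure.measure_univ_eq_zero]
  exact Measure.toSphere_ne_zero _

instance [Nontrivial E] : IsProbabilityMeasure (uniformSphere E) := by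
  refine ⟨?_⟩
  rw [uniformSphere, Measure.smul_apply, smul_eq_mul]
  exact ENNReal.inv_mul_cancel (toSphere_univ_ne_zero E) (measure_ne_top _ _)

instance [Nontrivial E] : IsProbabilityMeasure (sphereLaw E) :=
  Measure.isProbabilityMeasure_map measurable_subtype_coe.aemeasurable

theorem ae_norm_eq_one_sphereLaw : ∀ᵐ u ∂(sphereLaw E), ‖u‖ = 1 := by
  rw [sphereLaw, ae_map_iff measurable_subtype_coe.aemeasurable
    (measurableSet_eq_fun measurable_norm measurable_const)]
  exact Filter.Eventually.of_forall fun u => norm_eq_of_mem_sphere u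

variable {E}

theorem sphereLaw_apply {s : Set E} (hs : MeasurableSet s) :
    sphereLaw E s = ((volume : Measure E).toSphere univ)⁻¹ *
      (Module.finrank ℝ E * volume (Ioo (0 : ℝ) 1 • (s ∩ sphere (0 : E) 1))) := by
  rw [sphereLaw, Measure.map_apply measurable_subtype_coe hs, uniformSphere, Measure.smul_apply,
    smul_eq_mul, Measure.toSphere_apply' _ (measurable_subtype_coe hs),
    Subtype.image_preimage_coe, inter_comm]

/-- The law of a set is, up to normalization, the volume of the cone over it; a linear isometry
carries cones to cones and preserves volume. -/
theorem map_sphereLaw (T : E ≃ₗᵢ[ℝ] E) : (sphereLaw E).map T = sphereLaw E := by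
  ext s hs
  have hT : Measurable T := T.continuous.measurable
  rw [Measure.map_apply hT hs, sphereLaw_apply (hT hs), sphereLaw_apply hs]
  congr 2
  rw [← T.measurePreserving.measure_preimage_equiv
    (f := T.toHomeomorph.toMeasurableEquiv) (Ioo (0 : ℝ) 1 • (s ∩ sphere (0 : E) 1))]
  congr 1
  ext y
  simp only [mem_smul, mem_inter_iff, mem_preimage, mem_sphere_iff_norm, sub_zero]
  constructor
  · rintro ⟨r, hr, z, ⟨hz, hz1⟩, rfl⟩
    exact ⟨r, hr, T z, ⟨hz, by simpa using hz1⟩, by simp⟩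
  · rintro ⟨r, hr, z, ⟨hz, hz1⟩, h⟩
    refine ⟨r, hr, T.symm z, ⟨by simpa using hz, by simpa using hz1⟩, ?_⟩
    apply T.injective
    simpa using h

theorem integral_sphereLaw_comp (T : E ≃ₗᵢ[ℝ] E) (F : E → ℝ) :
    ∫ u, F (T u) ∂(sphereLaw E) = ∫ u, F u ∂(sphereLaw E) := by
  conv_rhs => rw [← map_sphereLaw T]
  exact (integral_map_equiv T.toHomeomorph.toMeasurableEquiv F).symm

theorem integrable_sphereLaw [Nontrivial E] {F : E → ℝ} (hF : Continuous F) :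
    Integrable F (sphereLaw E) := by
  obtain ⟨C, hC⟩ := (isCompact_sphere (0 : E) 1).exists_bound_of_continuousOn hF.continuousOn
  refine Integrable.of_bound hF.aestronglyMeasurable C ?_
  filter_upwards [ae_norm_eq_one_sphereLaw E] with u hu
  exact hC u (by simpa using hu)

/-- Reflection in the hyperplane orthogonal to e − f exchanges two vectors of equal norm. -/
theorem integral_inner_sphereLaw_congr {e f : E} (h : ‖e‖ = ‖f‖) (F : ℝ → ℝ) :
    ∫ u, F (inner ℝ e u) ∂(sphereLaw E) = ∫ u, F (inner ℝ f u) ∂(sphereLaw E) := by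
  let T := (ℝ ∙ (e - f))ᗮ.reflection
  have hT : T e = f := Submodule.reflection_sub h
  rw [← hT, ← integral_sphereLaw_comp T (fun u => F (inner ℝ (T e) u))]
  simp [LinearIsometryEquiv.inner_map_map]

theorem integral_inner_sq_sphereLaw [Nontrivial E] {e : E} (he : ‖e‖ = 1) :
    ∫ u, inner ℝ e u ^ 2 ∂(sphereLaw E) = 1 / Module.finrank ℝ E := by
  let b := stdOrthonormalBasis ℝ E
  have h1 : ∫ u, ∑ j, inner ℝ (b j) u ^ 2 ∂(sphereLaw E) = 1 := by
    have : (fun u => ∑ j, inner ℝ (b j) u ^ 2) =ᵐ[sphereLaw E] fun _ => (1 : ℝ) := by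
      filter_upwards [ae_norm_eq_one_sphereLaw E] with u hu
      have := b.sum_sq_norm_inner_right u
      simpa [hu] using this
    rw [integral_congr_ae this]
    simp
  rw [integral_finsetSum _ fun j _ => integrable_sphereLaw (by fun_prop)] at h1
  have h2 : ∀ j, ∫ u, inner ℝ (b j) u ^ 2 ∂(sphereLaw E) = ∫ u, inner ℝ e u ^ 2 ∂(sphereLaw E) :=
    fun j => integral_inner_sphereLaw_congr (by simp [he]) (fun t => t ^ 2)
  simp only [h2, Finset.sum_const, Finset.card_univ, Fintype.card_fin, nsmul_eq_mul] at h1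
  have : (0 : ℝ) < Module.finrank ℝ E := by exact_mod_cast Module.finrank_pos
  field_simp
  linarith

/-- Both e + f and e − f have the norm of √2 e, so their fourth moments equal 4A, where A is that of
e. Adding the two expansions cancels the odd terms and leaves 8A = 4A + 12B, with B the mixed
moment. -/
theorem integral_inner_pow_four_eq [Nontrivial E] {e f : E} (he : ‖e‖ = 1) (hf : ‖f‖ = 1)
    (hef : inner ℝ e f = 0) :
    ∫ u, inner ℝ e u ^ 4 ∂(sphereLaw E) =
      3 * ∫ u, inner ℝ e u ^ 2 * inner ℝ f u ^ 2 ∂(sphereLaw E) := by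
  have hn : ∀ s : ℝ, s ^ 2 = 1 → ‖e + s • f‖ = ‖(√2) • e‖ := by
    intro s hs
    rw [← sq_eq_sq₀ (norm_nonneg _) (norm_nonneg _), norm_add_sq_real, norm_smul, norm_smul,
      mul_pow, mul_pow, Real.norm_eq_abs, Real.norm_eq_abs, sq_abs, sq_abs, inner_smul_right, hef,
      he, hf, hs, Real.sq_sqrt (by norm_num)]
    norm_num
  have h2 : (√2) ^ 4 = 4 := by
    rw [show (4 : ℕ) = 2 * 2 from rfl, pow_mul, Real.sq_sqrt (by norm_num)]; norm_num
  have hp : ∀ s : ℝ, s ^ 2 = 1 → ∫ u, (inner ℝ e u + s * inner ℝ f u) ^ 4 ∂(sphereLaw E) =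
      4 * ∫ u, inner ℝ e u ^ 4 ∂(sphereLaw E) := by
    intro s hs
    have := integral_inner_sphereLaw_congr (hn s hs) (fun t => t ^ 4)
    simpa [inner_add_left, inner_smul_left, mul_pow, h2, integral_const_mul] using this
  have hsum := congrArg₂ (· + ·) (hp 1 (by norm_num)) (hp (-1) (by norm_num))
  rw [← integral_add (integrable_sphereLaw (by fun_prop)) (integrable_sphereLaw (by fun_prop))]
    at hsum
  have hf4 : ∫ u, inner ℝ f u ^ 4 ∂(sphereLaw E) = ∫ u, inner ℝ e u ^ 4 ∂(sphereLaw E) :=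
    integral_inner_sphereLaw_congr (by rw [he, hf]) (fun t => t ^ 4)
  have hexp : ∀ u : E, (inner ℝ e u + 1 * inner ℝ f u) ^ 4 + (inner ℝ e u + -1 * inner ℝ f u) ^ 4 =
      (2 * inner ℝ e u ^ 4 + 2 * inner ℝ f u ^ 4) + 12 * (inner ℝ e u ^ 2 * inner ℝ f u ^ 2) :=
    fun u => by ring
  simp only [hexp] at hsum
  rw [integral_add (integrable_sphereLaw (by fun_prop)) (integrable_sphereLaw (by fun_prop)),
    integral_add (integrable_sphereLaw (by fun_prop)) (integrable_sphereLaw (by fun_prop)),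
    integral_const_mul, integral_const_mul, integral_const_mul, hf4] at hsum
  linarith

/-- Multiplying 1 = ∑ⱼ ⟨bⱼ, u⟩² by ⟨e, u⟩² and integrating, for an orthonormal basis containing e,
gives 1/N = A + (N − 1)A/3; the mixed moment is A/3. -/
theorem integral_inner_sq_mul_inner_sq [Nontrivial E] {e f : E} (he : ‖e‖ = 1) (hf : ‖f‖ = 1)
    (hef : inner ℝ e f = 0) :
    ∫ u, inner ℝ e u ^ 2 * inner ℝ f u ^ 2 ∂(sphereLaw E) =
      1 / (Module.finrank ℝ E * (Module.finrank ℝ E + 2)) := by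
  classical
  have hon : Orthonormal ℝ (Subtype.val : ({e} : Set E) → E) :=
    ⟨fun i => by rw [i.2, he], fun i j hij => (hij (Subsingleton.elim i j)).elim⟩
  obtain ⟨s, b, hb, hbs⟩ := hon.exists_orthonormalBasis_extension
  have hes : e ∈ s := by exact_mod_cast hb rfl
  set i₀ : s := ⟨e, hes⟩
  have hbe : b i₀ = e := by rw [hbs]
  set A := ∫ u, inner ℝ e u ^ 4 ∂(sphereLaw E) with hA
  have hB : ∀ g : E, ‖g‖ = 1 → inner ℝ e g = 0 →
      ∫ u, inner ℝ e u ^ 2 * inner ℝ g u ^ 2 ∂(sphereLaw E) = A / 3 := fun g hg hg' => by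
    rw [hA, integral_inner_pow_four_eq he hg hg']; ring
  have h1 : ∫ u, ∑ j, inner ℝ e u ^ 2 * inner ℝ (b j) u ^ 2 ∂(sphereLaw E) =
      1 / Module.finrank ℝ E := by
    rw [← integral_inner_sq_sphereLaw he]
    apply integral_congr_ae
    filter_upwards [ae_norm_eq_one_sphereLaw E] with u hu
    have := b.sum_sq_norm_inner_right u
    rw [← Finset.mul_sum]
    simp only [Real.norm_eq_abs, sq_abs, hu] at this
    rw [this]; ring
  rw [integral_finsetSum _ fun j _ => integrable_sphereLaw (by fun_prop),
    ← Finset.add_sum_erase _ _ (Finset.mem_univ i₀)] at h1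
  have h2 : ∀ j ∈ Finset.univ.erase i₀,
      ∫ u, inner ℝ e u ^ 2 * inner ℝ (b j) u ^ 2 ∂(sphereLaw E) = A / 3 := by
    intro j hj
    apply hB _ (by simp)
    rw [← hbe]
    exact b.orthonormal.2 (Finset.ne_of_mem_erase hj).symm
  have h3 : ∫ u, inner ℝ e u ^ 2 * inner ℝ (b i₀) u ^ 2 ∂(sphereLaw E) = A := by
    rw [hbe]; congr 1; ext u; ring
  have hcard : (Fintype.card s : ℝ) = Module.finrank ℝ E := by
    rw [Module.finrank_eq_card_basis b.toBasis]
  have hpos : (0 : ℝ) < Module.finrank ℝ E := by exact_mod_cast Module.finrank_pos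
  have hc1 : 1 ≤ Fintype.card s := Fintype.card_pos_iff.2 ⟨i₀⟩
  rw [Finset.sum_congr rfl h2, h3, Finset.sum_const, Finset.card_erase_of_mem (Finset.mem_univ _),
    Finset.card_univ, nsmul_eq_mul, Nat.cast_sub hc1, hcard] at h1
  rw [hB f hf hef]
  push_cast at h1
  field_simp at h1 ⊢
  linarith

end SphereLaw

/-! ### Cap estimates and exponential moments of coordinates -/

section SphereTail

open Metric Set
open scoped Pointwise ENNReal

/-- Three regimes. For s² ≤ 1/2 the ball about s e of radius √(1 − s²) works; for larger s ≤ 1, the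
ball about e/(2s) of radius 1/(2s), with the origin on its boundary; for s > 1 the cap is empty. -/
theorem exists_cap_cone_subset_closedBall {E : Type*} [NormedAddCommGroup E]
    [InnerProductSpace ℝ E] {e : E} (he : ‖e‖ = 1) {s : ℝ} (hs : 0 ≤ s) :
    ∃ c : E, ∃ r : ℝ, 0 ≤ r ∧ r ≤ Real.exp (-(s ^ 2 / 4)) ∧ ∀ u : E, s ≤ inner ℝ e u → ‖u‖ = 1 →
      ∀ t ∈ Ioo (0 : ℝ) 1, t • u ∈ closedBall c r := by
  have hexp : Real.exp (-(s ^ 2 / 4)) ^ 2 = Real.exp (-(s ^ 2 / 2)) := by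
    rw [← Real.exp_nat_mul]; congr 1; push_cast; ring
  have hdist : ∀ (a t : ℝ) (u : E), ‖u‖ = 1 →
      ‖t • u - a • e‖ ^ 2 = t ^ 2 - 2 * (t * a * inner ℝ e u) + a ^ 2 := by
    intro a t u hu
    rw [norm_sub_sq_real, norm_smul, norm_smul, mul_pow, mul_pow, hu, he, inner_smul_left,
      inner_smul_right, real_inner_comm]
    simp
    ring
  rcases le_or_gt (s ^ 2) (1 / 2) with h | h
  · refine ⟨s • e, √(1 - s ^ 2), Real.sqrt_nonneg _, ?_, ?_⟩
    · rw [Real.sqrt_le_left (Real.exp_pos _).le, hexp]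
      have := Real.add_one_le_exp (-(s ^ 2 / 2))
      nlinarith [sq_nonneg s]
    · rintro u hsu hu t ⟨ht0, ht1⟩
      rw [mem_closedBall_iff_norm]
      apply Real.le_sqrt_of_sq_le
      rw [hdist s t u hu]
      have : t * s * s ≤ t * s * inner ℝ e u := by gcongr
      nlinarith [mul_nonneg ht0.le (sub_nonneg.2 ht1.le), sq_nonneg s,
        mul_nonneg (sub_nonneg.2 ht1.le) (sub_nonneg.2 h)]
  rcases le_or_gt s 1 with h1 | h1
  · have hs0 : 0 < s := by nlinarith
    refine ⟨(1 / (2 * s)) • e, 1 / (2 * s), by positivity, ?_, ?_⟩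
    · rw [← sq_le_sq₀ (by positivity) (Real.exp_pos _).le, hexp]
      have := Real.add_one_le_exp (-(s ^ 2 / 2))
      have h2 : (1 / (2 * s)) ^ 2 ≤ 1 / 2 := by
        rw [div_pow, one_pow, mul_pow]
        apply one_div_le_one_div_of_le <;> linarith
      nlinarith
    · rintro u hsu hu t ⟨ht0, ht1⟩
      rw [mem_closedBall_iff_norm, ← sq_le_sq₀ (norm_nonneg _) (by positivity), hdist _ t u hu]
      have h3 : t * (1 / (2 * s)) * s ≤ t * (1 / (2 * s)) * inner ℝ e u := by gcongr
      have h4 : t * (1 / (2 * s)) * s = t / 2 := by field_simp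
      nlinarith
  · refine ⟨0, 0, le_rfl, (Real.exp_pos _).le, fun u hsu hu => ?_⟩
    have := real_inner_le_norm e u
    rw [he, hu] at this
    linarith

variable {E : Type*} [NormedAddCommGroup E] [InnerProductSpace ℝ E] [FiniteDimensional ℝ E]
  [MeasurableSpace E] [BorelSpace E]

/-- The uniform measure of s is the ratio of the volume of its cone to that of the unit ball. -/
theorem sphereLaw_le_of_cone_subset [Nontrivial E] {s : Set E} (hs : MeasurableSet s) {c : E}
    {r : ℝ} (hr : 0 ≤ r)
    (h : ∀ u ∈ s, ‖u‖ = 1 → ∀ t ∈ Ioo (0 : ℝ) 1, t • u ∈ closedBall c r) :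
    (sphereLaw E).real s ≤ r ^ Module.finrank ℝ E := by
  have hsub : Ioo (0 : ℝ) 1 • (s ∩ sphere (0 : E) 1) ⊆ closedBall c r := by
    rintro y ⟨t, ht, u, ⟨hu, hu1⟩, rfl⟩
    exact h u hu (by simpa using hu1) t ht
  apply ENNReal.toReal_le_of_le_ofReal (by positivity)
  have h0 := toSphere_univ_ne_zero E
  rw [sphereLaw_apply hs, ← ENNReal.div_eq_inv_mul]
  refine ENNReal.div_le_of_le_mul ?_
  rw [Measure.toSphere_apply_univ, mul_left_comm, ← Measure.addHaar_closedBall _ c hr]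
  gcongr

theorem sphereLaw_cap_le [Nontrivial E] {e : E} (he : ‖e‖ = 1) {s : ℝ} (hs : 0 ≤ s) :
    (sphereLaw E).real {u | s ≤ inner ℝ e u} ≤
      Real.exp (-(Module.finrank ℝ E * s ^ 2 / 4)) := by
  obtain ⟨c, r, hr, hr1, h⟩ := exists_cap_cone_subset_closedBall he hs
  refine (sphereLaw_le_of_cone_subset (measurableSet_le measurable_const (by fun_prop)) hr
    h).trans ?_
  calc r ^ Module.finrank ℝ E ≤ Real.exp (-(s ^ 2 / 4)) ^ Module.finrank ℝ E := by gcongr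
    _ = _ := by rw [← Real.exp_nat_mul]; congr 1; ring

theorem sphereLaw_sq_tail_le [Nontrivial E] {e : E} (he : ‖e‖ = 1) {t : ℝ} (ht : 0 ≤ t) :
    (sphereLaw E).real {u | t ≤ Module.finrank ℝ E * inner ℝ e u ^ 2} ≤
      2 * Real.exp (-(t / 4)) := by
  have hN : (0 : ℝ) < Module.finrank ℝ E := by exact_mod_cast Module.finrank_pos
  set s := √(t / Module.finrank ℝ E) with hs
  have hs2 : Module.finrank ℝ E * s ^ 2 = t := by
    rw [hs, Real.sq_sqrt (by positivity)]; field_simp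
  have hsub : {u : E | t ≤ Module.finrank ℝ E * inner ℝ e u ^ 2} ⊆
      {u | s ≤ inner ℝ e u} ∪ {u | s ≤ inner ℝ (-e) u} := by
    intro u hu
    simp only [mem_ofPred_eq, mem_union, inner_neg_left] at hu ⊢
    have : s ≤ |inner ℝ e u| := by
      rw [hs, ← Real.sqrt_sq_eq_abs]
      apply Real.sqrt_le_sqrt
      rw [div_le_iff₀ hN]; linarith
    exact le_abs.1 this
  have h1 := sphereLaw_cap_le he (Real.sqrt_nonneg (t / Module.finrank ℝ E))
  have h2 := sphereLaw_cap_le (e := -e) (by simpa using he)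
    (Real.sqrt_nonneg (t / Module.finrank ℝ E))
  rw [← hs, hs2] at h1 h2
  have h3 := (measureReal_mono hsub (by finiteness)).trans
    (measureReal_union_le (μ := sphereLaw E) _ _)
  linarith

/-- A bound for the exponential moments of the coordinates of a uniform random vector on a sphere
of radius `√N` in an `N`-dimensional space; it does not depend on `N`. -/
noncomputable def expMomentBound : ℝ := 2 * Real.exp (1 / 16) * (1 - Real.exp (-(3 / 16)))⁻¹

/-- Slicing by the integer part k of the exponent variable, the tail 2e^{-k/4} beats the growth
e^{(k+1)/16}; the geometric series of ratio e^{-3/16} does not see the dimension. -/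
theorem integral_exp_inner_sq_le [Nontrivial E] {e : E} (he : ‖e‖ = 1) :
    ∫ u, Real.exp (1 / 16 * (Module.finrank ℝ E * inner ℝ e u ^ 2)) ∂(sphereLaw E) ≤
      expMomentBound := by
  set N := Module.finrank ℝ E
  let A : ℕ → Set E := fun k => {u | (k : ℝ) ≤ N * inner ℝ e u ^ 2}
  have hA : ∀ k, MeasurableSet (A k) := fun k =>
    measurableSet_le measurable_const (by fun_prop)
  have hint : ∀ k ∈ Finset.range (N + 1), Integrable
      ((A k).indicator fun _ => Real.exp (1 / 16 * (k + 1))) (sphereLaw E) := fun k _ =>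
    (integrable_const _).indicator (hA k)
  have hpt : ∀ᵐ u ∂(sphereLaw E), Real.exp (1 / 16 * (N * inner ℝ e u ^ 2)) ≤
      ∑ k ∈ Finset.range (N + 1), (A k).indicator (fun _ => Real.exp (1 / 16 * (k + 1))) u := by
    filter_upwards [ae_norm_eq_one_sphereLaw E] with u hu
    have hw0 : 0 ≤ N * inner ℝ e u ^ 2 := by positivity
    have hin : inner ℝ e u ^ 2 ≤ 1 := by
      have := abs_real_inner_le_norm e u
      rw [he, hu, one_mul] at this
      rw [← sq_abs]; nlinarith [abs_nonneg (inner ℝ e u)]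
    have hwN : N * inner ℝ e u ^ 2 ≤ N := mul_le_of_le_one_right (by positivity) hin
    have hk : ⌊N * inner ℝ e u ^ 2⌋₊ ∈ Finset.range (N + 1) := by
      rw [Finset.mem_range, Nat.lt_succ_iff]
      exact Nat.floor_le_of_le hwN
    refine le_trans ?_ (Finset.single_le_sum (f := fun k : ℕ =>
      (A k).indicator (fun _ => Real.exp (1 / 16 * (k + 1))) u) (fun k _ =>
        indicator_nonneg (fun _ _ => (Real.exp_pos _).le) _) hk)
    have hmem : u ∈ A ⌊N * inner ℝ e u ^ 2⌋₊ := Nat.floor_le hw0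
    rw [indicator_of_mem hmem]
    have := Nat.lt_floor_add_one (N * inner ℝ e u ^ 2)
    gcongr
  refine (integral_mono_ae (integrable_sphereLaw (by fun_prop))
    (integrable_finsetSum _ hint) hpt).trans ?_
  rw [integral_finsetSum _ hint]
  set q := Real.exp (-(3 / 16)) with hq
  have hq1 : q < 1 := by rw [hq, Real.exp_lt_one_iff]; norm_num
  have hterm : ∀ k : ℕ, ∫ u, (A k).indicator (fun _ => Real.exp (1 / 16 * (k + 1))) u
      ∂(sphereLaw E) ≤ 2 * Real.exp (1 / 16) * q ^ k := by
    intro k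
    rw [integral_indicator_const _ (hA k), smul_eq_mul]
    have := sphereLaw_sq_tail_le he (t := k) (by positivity)
    calc _ ≤ 2 * Real.exp (-(k / 4)) * Real.exp (1 / 16 * (k + 1)) := by gcongr
      _ = 2 * Real.exp (1 / 16) * q ^ k := by
        rw [hq, ← Real.exp_nat_mul, mul_assoc, mul_assoc, ← Real.exp_add, ← Real.exp_add]
        congr 2; ring
  refine (Finset.sum_le_sum fun k _ => hterm k).trans ?_
  rw [← Finset.mul_sum, expMomentBound, ← hq]
  gcongr
  rw [← tsum_geometric_of_lt_one (Real.exp_pos _).le hq1]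
  exact (summable_geometric_of_lt_one (Real.exp_pos _).le hq1).sum_le_tsum _
    fun _ _ => by positivity

end SphereTail

/-! ### Finite nets -/

section Net

variable {E : Type*} [NormedAddCommGroup E] [InnerProductSpace ℝ E] [FiniteDimensional ℝ E]

/-- The coordinates are rounded to multiples of 1/k in [−1, 1], which have 2k + 1 values. This is
cruder than a volumetric net, but the resulting logarithm is affordable when m is of order n log n.
-/
theorem exists_grid (k : ℕ) (hk : 0 < k) :
    ∃ G : Finset E, G.card ≤ (2 * k + 1) ^ Module.finrank ℝ E ∧
      ∀ v : E, ‖v‖ ≤ 1 → ∃ g ∈ G, ‖v - g‖ ≤ Module.finrank ℝ E / k := by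
  classical
  let b := stdOrthonormalBasis ℝ E
  let g : (Fin (Module.finrank ℝ E) → Fin (2 * k + 1)) → E :=
    fun p => ∑ j, ((((p j : ℕ) : ℝ) - k) / k) • b j
  refine ⟨Finset.univ.image g, Finset.card_image_le.trans (by simp), fun v hv => ?_⟩
  have hk0 : (0 : ℝ) < k := by exact_mod_cast hk
  have hcoord : ∀ j, ∃ p : Fin (2 * k + 1), |inner ℝ (b j) v - (((p : ℕ) : ℝ) - k) / k| ≤ 1 / k := by
    intro j
    have hx : |inner ℝ (b j) v| ≤ 1 :=
      (abs_real_inner_le_norm _ _).trans (by simpa using hv)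
    set x := inner ℝ (b j) v
    obtain ⟨hx1, hx2⟩ := abs_le.1 hx
    have h0 : 0 ≤ k * x + k := by nlinarith
    have hle : ⌊k * x + k⌋₊ ≤ 2 * k := by
      apply Nat.floor_le_of_le
      push_cast; nlinarith
    refine ⟨⟨⌊k * x + k⌋₊, by omega⟩, ?_⟩
    have h1 := Nat.floor_le h0
    have h2 := Nat.lt_floor_add_one (k * x + k)
    simp only
    have h3 : x - ((⌊k * x + k⌋₊ : ℝ) - k) / k = (k * x + k - ⌊k * x + k⌋₊) / k := by
      field_simp; ring
    rw [h3, abs_of_nonneg (div_nonneg (by linarith) hk0.le)]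
    gcongr
    linarith
  choose p hp using hcoord
  refine ⟨g p, Finset.mem_image_of_mem _ (Finset.mem_univ _), ?_⟩
  have hv' : v = ∑ j, inner ℝ (b j) v • b j := (b.sum_repr' v).symm
  calc ‖v - g p‖ = ‖∑ j, (inner ℝ (b j) v - (((p j : ℕ) : ℝ) - k) / k) • b j‖ := by
        simp only [g, sub_smul, Finset.sum_sub_distrib]
        rw [← hv']
    _ ≤ ∑ j, ‖(inner ℝ (b j) v - (((p j : ℕ) : ℝ) - k) / k) • b j‖ := norm_sum_le _ _
    _ ≤ ∑ _j : Fin (Module.finrank ℝ E), (1 / k : ℝ) := by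
        apply Finset.sum_le_sum
        intro j _
        rw [norm_smul, b.orthonormal.1 j, mul_one]
        exact hp j
    _ = _ := by simp; ring

/-- Each grid point close to A is replaced by a point of A, which doubles the radius. Net points
must lie in A because the moment bounds are known only there. -/
theorem exists_net_subset (k : ℕ) (hk : 0 < k) (A : Set E) (hA : ∀ v ∈ A, ‖v‖ ≤ 1) :
    ∃ G : Finset E, G.card ≤ (2 * k + 1) ^ Module.finrank ℝ E ∧ (∀ g ∈ G, g ∈ A) ∧
      ∀ v ∈ A, ∃ g ∈ G, ‖v - g‖ ≤ 2 * (Module.finrank ℝ E / k) := by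
  classical
  obtain ⟨G, hG, hcov⟩ := exists_grid (E := E) k hk
  set r : ℝ := Module.finrank ℝ E / k
  let near : E → Prop := fun g => ∃ v ∈ A, ‖v - g‖ ≤ r
  let pick : E → E := fun g => if h : near g then h.choose else 0
  have hpick : ∀ g, near g → pick g ∈ A ∧ ‖pick g - g‖ ≤ r := fun g h => by
    simp only [pick, dif_pos h]; exact h.choose_spec
  refine ⟨(G.filter near).image pick,
    Finset.card_image_le.trans ((Finset.card_filter_le _ _).trans hG), ?_, fun v hv => ?_⟩
  · intro g hg
    obtain ⟨g', hg', rfl⟩ := Finset.mem_image.1 hg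
    exact (hpick g' (Finset.mem_filter.1 hg').2).1
  · obtain ⟨g, hg, hvg⟩ := hcov v (hA v hv)
    have hn : near g := ⟨v, hv, hvg⟩
    refine ⟨pick g, Finset.mem_image_of_mem _ (Finset.mem_filter.2 ⟨hg, hn⟩), ?_⟩
    have := norm_sub_le_norm_sub_add_norm_sub v g (pick g)
    rw [norm_sub_rev g] at this
    linarith [(hpick g hn).2]

end Net

/-! ### Exponential tail bounds, for one function and for a family -/

section Chernoff

theorem exp_le_one_add_add_sq_mul_exp_abs (x : ℝ) :
    Real.exp x ≤ 1 + x + x ^ 2 * Real.exp |x| := by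
  have h := Complex.norm_exp_sub_sum_le_norm_mul_exp (x : ℂ) 2
  have h1 : Complex.exp x - ∑ i ∈ Finset.range 2, (x : ℂ) ^ i / (i.factorial : ℂ) =
      ((Real.exp x - (1 + x) : ℝ) : ℂ) := by
    simp [Finset.sum_range_succ]
  rw [h1, Complex.norm_real, Complex.norm_real, Real.norm_eq_abs, Real.norm_eq_abs, sq_abs] at h
  linarith [le_abs_self (Real.exp x - (1 + x))]

/-- The linear term is kept exactly. In the remainder y²e^{|sy|}, with W = p + q, each of W² and
e^{|sy|} costs a factor e^{tW/4}; the product e^{tW/2} is at most the average of e^{tp} and e^{tq}.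
-/
theorem exp_neg_mul_le {t s D y p q : ℝ} (ht : 0 < t) (hs : 0 ≤ s)
    (hsD : s * D ≤ t / 4) (hp : 0 ≤ p) (hq : 0 ≤ q) (hy : |y| ≤ D * (p + q)) :
    Real.exp (-(s * y)) ≤
      1 - s * y + s ^ 2 * (D ^ 2 * (16 / t ^ 2) * (Real.exp (t * p) + Real.exp (t * q))) := by
  have h1 := exp_le_one_add_add_sq_mul_exp_abs (-(s * y))
  set W := p + q with hW
  have hW0 : 0 ≤ W := by positivity
  have hsy : |-(s * y)| ≤ t / 4 * W := by
    rw [abs_neg, abs_mul, abs_of_nonneg hs]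
    calc s * |y| ≤ s * (D * W) := by gcongr
      _ = s * D * W := by ring
      _ ≤ _ := by gcongr
  have hy2 : y ^ 2 ≤ D ^ 2 * W ^ 2 := by
    rw [← mul_pow, ← sq_abs]
    gcongr
  have hW2 : W ^ 2 ≤ 32 / t ^ 2 * Real.exp (t / 4 * W) := by
    have := Real.quadratic_le_exp_of_nonneg (x := t / 4 * W) (by positivity)
    have h3 : (t / 4 * W) ^ 2 / 2 ≤ Real.exp (t / 4 * W) := by
      have : 0 ≤ t / 4 * W := by positivity
      linarith
    calc W ^ 2 = 32 / t ^ 2 * ((t / 4 * W) ^ 2 / 2) := by field_simp; ring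
      _ ≤ _ := by gcongr
  have hexp : Real.exp (t / 4 * W) * Real.exp (t / 4 * W) ≤
      (Real.exp (t * p) + Real.exp (t * q)) / 2 := by
    have e1 : Real.exp (t / 4 * W) * Real.exp (t / 4 * W) =
        Real.exp (t / 2 * p) * Real.exp (t / 2 * q) := by
      rw [← Real.exp_add, ← Real.exp_add, hW]; congr 1; ring
    have e2 : ∀ p, Real.exp (t * p) = Real.exp (t / 2 * p) ^ 2 := fun p => by
      rw [← Real.exp_nat_mul]; congr 1; push_cast; ring
    rw [e1, e2, e2]
    nlinarith [sq_nonneg (Real.exp (t / 2 * p) - Real.exp (t / 2 * q))]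
  have h4 : (-(s * y)) ^ 2 * Real.exp |-(s * y)| ≤
      s ^ 2 * (D ^ 2 * (16 / t ^ 2) * (Real.exp (t * p) + Real.exp (t * q))) := by
    calc (-(s * y)) ^ 2 * Real.exp |-(s * y)| = s ^ 2 * (y ^ 2 * Real.exp |-(s * y)|) := by ring
      _ ≤ s ^ 2 * ((D ^ 2 * (32 / t ^ 2 * Real.exp (t / 4 * W))) * Real.exp (t / 4 * W)) := by
        gcongr
        exact hy2.trans (by gcongr)
      _ = s ^ 2 * (D ^ 2 * (32 / t ^ 2) * (Real.exp (t / 4 * W) * Real.exp (t / 4 * W))) := by ring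
      _ ≤ s ^ 2 * (D ^ 2 * (32 / t ^ 2) * ((Real.exp (t * p) + Real.exp (t * q)) / 2)) := by
        gcongr
      _ = _ := by ring
  linarith

theorem integral_exp_neg_mul_le {α : Type*} [MeasurableSpace α] {ν : Measure α}
    [IsProbabilityMeasure ν] {t s D K a : ℝ} {f p q : α → ℝ} (ht : 0 < t) (hs : 0 ≤ s)
    (hsD : s * D ≤ t / 4) (hp : ∀ u, 0 ≤ p u) (hq : ∀ u, 0 ≤ q u)
    (hf : ∀ᵐ u ∂ν, |f u| ≤ D * (p u + q u)) (hfi : Integrable f ν)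
    (hpi : Integrable (fun u => Real.exp (t * p u)) ν)
    (hqi : Integrable (fun u => Real.exp (t * q u)) ν)
    (hpK : ∫ u, Real.exp (t * p u) ∂ν ≤ K) (hqK : ∫ u, Real.exp (t * q u) ∂ν ≤ K)
    (ha : a ≤ ∫ u, f u ∂ν) :
    ∫ u, Real.exp (-(s * f u)) ∂ν ≤
      Real.exp (-(s * a) + s ^ 2 * (D ^ 2 * (32 / t ^ 2) * K)) := by
  have hpq : Integrable (fun u => Real.exp (t * p u) + Real.exp (t * q u)) ν := hpi.add hqi
  have hf1 : Integrable (fun u => 1 - s * f u) ν := (integrable_const _).sub (hfi.const_mul _)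
  have h1 : ∫ u, Real.exp (-(s * f u)) ∂ν ≤ ∫ u, (1 - s * f u + s ^ 2 * (D ^ 2 * (16 / t ^ 2) *
      (Real.exp (t * p u) + Real.exp (t * q u)))) ∂ν := by
    apply integral_mono_of_nonneg (Filter.Eventually.of_forall fun u => (Real.exp_pos _).le)
    · exact hf1.add ((hpq.const_mul _).const_mul _)
    · filter_upwards [hf] with u hu
      exact exp_neg_mul_le ht hs hsD (hp u) (hq u) hu
  rw [integral_add hf1 ((hpq.const_mul _).const_mul _),
    integral_sub (integrable_const _) (hfi.const_mul _), integral_const_mul, integral_const_mul,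
    integral_const_mul, integral_add hpi hqi] at h1
  simp only [integral_const, probReal_univ, smul_eq_mul, mul_one] at h1
  refine h1.trans (le_trans ?_ (Real.add_one_le_exp _))
  have h2 : s * a ≤ s * ∫ u, f u ∂ν := by gcongr
  have h3 : D ^ 2 * (16 / t ^ 2) * (∫ u, Real.exp (t * p u) ∂ν + ∫ u, Real.exp (t * q u) ∂ν) ≤
      D ^ 2 * (32 / t ^ 2) * K := by
    calc _ ≤ D ^ 2 * (16 / t ^ 2) * (K + K) := by gcongr
      _ = _ := by ring
  have h4 := mul_le_mul_of_nonneg_left h3 (sq_nonneg s)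
  linarith

variable {E : Type*} [NormedAddCommGroup E] [InnerProductSpace ℝ E] [FiniteDimensional ℝ E]
  [MeasurableSpace E] [BorelSpace E]
  {Ω : Type*} [MeasurableSpace Ω] {P : Measure Ω} [IsProbabilityMeasure P]
  {m : ℕ} {z : Fin m → Ω → Metric.sphere (0 : E) 1}

/-- Markov's inequality for exp(−s ∑ f(zᵢ)), which factors by independence; c is the exponential
gain per sample. -/
theorem measure_sum_le_le_exp (hind : iIndepFun z P) (hlaw : ∀ i, HasLaw (z i) (uniformSphere E) P)
    {f : E → ℝ} (hf : Continuous f) {s a c : ℝ} (hs : 0 ≤ s)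
    (hexp : ∫ u, Real.exp (-(s * f u)) ∂(sphereLaw E) ≤ Real.exp (-(s * a) - c)) :
    P.real {ω | ∑ i, f (z i ω) ≤ m * a} ≤ Real.exp (-(c * m)) := by
  have hfz : Measurable fun u : Metric.sphere (0 : E) 1 => f u :=
    (hf.comp continuous_subtype_val).measurable
  have haem : ∀ i, AEMeasurable (fun ω => f (z i ω)) P := fun i =>
    hfz.comp_aemeasurable (hlaw i).aemeasurable
  obtain ⟨C, hC⟩ := (isCompact_sphere (0 : E) 1).exists_bound_of_continuousOn hf.continuousOn
  have hmgf : ∀ i, mgf (fun ω => f (z i ω)) P (-s) ≤ Real.exp (-(s * a) - c) := by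
    intro i
    refine le_trans (le_of_eq ?_) hexp
    rw [sphereLaw, (MeasurableEmbedding.subtype_coe Metric.isClosed_sphere.measurableSet).integral_map]
    have := (hlaw i).integral_comp (f := fun u => Real.exp (-(s * f u)))
      (by fun_prop : Continuous fun u : Metric.sphere (0 : E) 1 =>
        Real.exp (-(s * f u))).aestronglyMeasurable
    rw [← this]
    simp [mgf]
  have hind' : iIndepFun (fun i ω => f (z i ω)) P :=
    hind.comp (fun _ u => f u) fun _ => hfz
  have hsum : mgf (∑ i, fun ω => f (z i ω)) P (-s) ≤ Real.exp (-(s * a) - c) ^ m := by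
    rw [hind'.mgf_sum₀ haem]
    calc _ ≤ ∏ _i : Fin m, Real.exp (-(s * a) - c) :=
          Finset.prod_le_prod (fun _ _ => mgf_nonneg) fun i _ => hmgf i
      _ = _ := by simp
  have hint : Integrable (fun ω => Real.exp (-s * (∑ i, fun ω => f (z i ω)) ω)) P := by
    refine Integrable.of_bound (C := Real.exp (s * (m * C))) ?_ ?_
    · have : AEMeasurable (∑ i, fun ω => f (z i ω)) P := Finset.aemeasurable_sum _ fun i _ => haem i
      exact (Real.measurable_exp.comp_aemeasurable (this.const_mul _)).aestronglyMeasurable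
    · refine Filter.Eventually.of_forall fun ω => ?_
      rw [Real.norm_eq_abs, Real.abs_exp, Real.exp_le_exp, neg_mul, ← mul_neg]
      gcongr
      rw [Finset.sum_apply, ← Finset.sum_neg_distrib]
      calc ∑ i, -f (z i ω) ≤ ∑ _i : Fin m, C :=
            Finset.sum_le_sum fun i _ => (neg_le_abs _).trans (hC _ (z i ω).2)
        _ = _ := by simp
  have h := measure_le_le_exp_mul_mgf (m * a) (neg_nonpos.2 hs) hint
  simp only [Finset.sum_apply] at h
  refine h.trans ?_
  calc _ ≤ Real.exp (-(-s) * (m * a)) * Real.exp (-(s * a) - c) ^ m := by gcongr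
    _ = _ := by rw [← Real.exp_nat_mul, ← Real.exp_add]; congr 1; ring

/-- A violation at some v forces, by the Lipschitz bound, a slightly weaker violation at a nearby
net point, and the union bound runs over the net. -/
theorem measure_exists_sum_lt_le (hind : iIndepFun z P)
    (hlaw : ∀ i, HasLaw (z i) (uniformSphere E) P)
    {A : Set E} (hA : ∀ v ∈ A, ‖v‖ ≤ 1) {f : E → E → ℝ} (hf : ∀ v ∈ A, Continuous (f v))
    {L s a c : ℝ} (hL : 0 ≤ L)
    (hfL : ∀ v ∈ A, ∀ w ∈ A, ∀ u, ‖u‖ = 1 → |f v u - f w u| ≤ L * ‖v - w‖) (hs : 0 ≤ s)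
    (hexp : ∀ v ∈ A, ∫ u, Real.exp (-(s * f v u)) ∂(sphereLaw E) ≤ Real.exp (-(s * a) - c))
    {k : ℕ} (hk : 0 < k) :
    P.real {ω | ∃ v ∈ A, ∑ i, f v (z i ω) < m * (a - L * (2 * (Module.finrank ℝ E / k)))} ≤
      (2 * k + 1) ^ Module.finrank ℝ E * Real.exp (-(c * m)) := by
  obtain ⟨G, hG, hGA, hcov⟩ := exists_net_subset k hk A hA
  have hsub : {ω | ∃ v ∈ A, ∑ i, f v (z i ω) < m * (a - L * (2 * (Module.finrank ℝ E / k)))} ⊆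
      ⋃ g ∈ G, {ω | ∑ i, f g (z i ω) ≤ m * a} := by
    rintro ω ⟨v, hv, hlt⟩
    obtain ⟨g, hg, hvg⟩ := hcov v hv
    refine Set.mem_biUnion hg ?_
    change ∑ i, f g (z i ω) ≤ m * a
    have hdiff : ∑ i, f g (z i ω) - ∑ i, f v (z i ω) ≤
        m * (L * (2 * (Module.finrank ℝ E / k))) := by
      rw [← Finset.sum_sub_distrib]
      calc ∑ i, (f g (z i ω) - f v (z i ω)) ≤
          ∑ _i : Fin m, (L * (2 * (Module.finrank ℝ E / k))) := by
            refine Finset.sum_le_sum fun i _ => (le_abs_self _).trans ?_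
            refine (hfL g (hGA g hg) v hv _ (norm_eq_of_mem_sphere _)).trans ?_
            rw [norm_sub_rev]
            gcongr
        _ = _ := by simp
    linarith
  refine (measureReal_mono hsub (measure_ne_top _ _)).trans ?_
  refine (measureReal_biUnion_finset_le _ _).trans ?_
  calc ∑ g ∈ G, P.real {ω | ∑ i, f g (z i ω) ≤ m * a} ≤ ∑ _g ∈ G, Real.exp (-(c * m)) :=
        Finset.sum_le_sum fun g hg =>
          measure_sum_le_le_exp hind hlaw (hf g (hGA g hg)) hs (hexp g (hGA g hg))
    _ = G.card * Real.exp (-(c * m)) := by simp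
    _ ≤ _ := by gcongr; exact_mod_cast hG

end Chernoff

/-! ### Measurements of normal and tangent matrices -/

section Intensity

/-- The real inner product of `E` is the real part of its `𝕜`-valued one, and `E` has the real
dimension of an `n`-dimensional space over `𝕜`. -/
structure IsRealification (𝕜 E : Type*) [RCLike 𝕜] [NormedAddCommGroup E]
    [InnerProductSpace 𝕜 E] [InnerProductSpace ℝ E] (n : ℕ) : Prop where
  inner_eq : ∀ x y : E, inner ℝ x y = RCLike.re (inner 𝕜 x y)
  finrank_eq : ((RCLike.I : 𝕜) = 0 ∧ Module.finrank ℝ E = n) ∨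
    (RCLike.im (RCLike.I : 𝕜) = 1 ∧ Module.finrank ℝ E = 2 * n)

variable (𝕜 : Type*) [RCLike 𝕜] {E : Type*} [NormedAddCommGroup E] [InnerProductSpace 𝕜 E]

/-- The squared modulus of `⟨v, √n u⟩`. -/
noncomputable def scaledIntensity (n : ℕ) (v u : E) : ℝ := n * ‖inner 𝕜 v u‖ ^ 2

/-- The real part of `⟨x, √n u⟩ ⟨√n u, v⟩`. -/
noncomputable def crossIntensity (n : ℕ) (x v u : E) : ℝ :=
  n * RCLike.re (inner 𝕜 x u * inner 𝕜 u v)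

variable {𝕜}

theorem scaledIntensity_nonneg (n : ℕ) (v u : E) : 0 ≤ scaledIntensity 𝕜 n v u := by
  unfold scaledIntensity; positivity

theorem continuous_scaledIntensity (n : ℕ) (v : E) : Continuous (scaledIntensity 𝕜 n v) := by
  unfold scaledIntensity
  fun_prop

theorem continuous_crossIntensity (n : ℕ) (x v : E) : Continuous (crossIntensity 𝕜 n x v) := by
  unfold crossIntensity
  exact continuous_const.mul (RCLike.continuous_re.comp (by fun_prop))

theorem two_mul_abs_crossIntensity_le (n : ℕ) (x v u : E) :
    2 * |crossIntensity 𝕜 n x v u| ≤ scaledIntensity 𝕜 n x u + scaledIntensity 𝕜 n v u := by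
  unfold crossIntensity scaledIntensity
  have h := RCLike.abs_re_le_norm (inner 𝕜 x u * inner 𝕜 u v)
  rw [norm_mul, norm_inner_symm u v] at h
  rw [abs_mul, Nat.abs_cast]
  have : 2 * |RCLike.re (inner 𝕜 x u * inner 𝕜 u v)| ≤ ‖inner 𝕜 x u‖ ^ 2 + ‖inner 𝕜 v u‖ ^ 2 := by
    nlinarith [sq_nonneg (‖inner 𝕜 x u‖ - ‖inner 𝕜 v u‖)]
  have := mul_le_mul_of_nonneg_left this (Nat.cast_nonneg (α := ℝ) n)
  linarith

theorem scaledIntensity_smul (n : ℕ) (c : 𝕜) (v u : E) :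
    scaledIntensity 𝕜 n (c • v) u = ‖c‖ ^ 2 * scaledIntensity 𝕜 n v u := by
  unfold scaledIntensity
  rw [inner_smul_left, norm_mul, RCLike.norm_conj]
  ring

theorem crossIntensity_add (n : ℕ) (x v w u : E) :
    crossIntensity 𝕜 n x (v + w) u = crossIntensity 𝕜 n x v u + crossIntensity 𝕜 n x w u := by
  unfold crossIntensity
  rw [inner_add_right, mul_add, map_add, mul_add]

theorem crossIntensity_sub (n : ℕ) (x v w u : E) :
    crossIntensity 𝕜 n x (v - w) u = crossIntensity 𝕜 n x v u - crossIntensity 𝕜 n x w u := by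
  unfold crossIntensity
  rw [inner_sub_right, mul_sub, map_sub, mul_sub]

theorem crossIntensity_ofReal_smul (n : ℕ) (r : ℝ) (x v u : E) :
    crossIntensity 𝕜 n x ((r : 𝕜) • v) u = r * crossIntensity 𝕜 n x v u := by
  unfold crossIntensity
  rw [inner_smul_right, mul_left_comm, RCLike.re_ofReal_mul]
  ring

/-- Imaginary multiples of x are invisible, since xh* + hx* does not change when they are added to
h. Hence the normalization Im ⟨x, h⟩ = 0 in the injectivity statements. -/
theorem crossIntensity_smul_self (n : ℕ) (c : 𝕜) (x u : E) :
    crossIntensity 𝕜 n x (c • x) u = RCLike.re c * scaledIntensity 𝕜 n x u := by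
  unfold crossIntensity scaledIntensity
  rw [inner_smul_right, mul_left_comm, ← inner_conj_symm u x, RCLike.mul_conj,
    ← RCLike.ofReal_pow, mul_comm c, RCLike.re_ofReal_mul]
  ring

theorem abs_scaledIntensity_sub_le (n : ℕ) {v w u : E} (hv : ‖v‖ = 1) (hw : ‖w‖ = 1)
    (hu : ‖u‖ = 1) :
    |scaledIntensity 𝕜 n v u - scaledIntensity 𝕜 n w u| ≤ 2 * n * ‖v - w‖ := by
  unfold scaledIntensity
  have h1 : |‖inner 𝕜 v u‖ - ‖inner 𝕜 w u‖| ≤ ‖v - w‖ := by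
    refine (abs_norm_sub_norm_le _ _).trans ?_
    rw [← inner_sub_left]
    simpa [hu] using norm_inner_le_norm (𝕜 := 𝕜) (v - w) u
  have h2 : ‖inner 𝕜 v u‖ ≤ 1 := by simpa [hu, hv] using norm_inner_le_norm (𝕜 := 𝕜) v u
  have h3 : ‖inner 𝕜 w u‖ ≤ 1 := by simpa [hu, hw] using norm_inner_le_norm (𝕜 := 𝕜) w u
  rw [← mul_sub, sq_sub_sq, abs_mul, Nat.abs_cast, abs_mul, abs_of_nonneg (by positivity)]
  calc (n : ℝ) * ((‖inner 𝕜 v u‖ + ‖inner 𝕜 w u‖) * |‖inner 𝕜 v u‖ - ‖inner 𝕜 w u‖|)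
      ≤ n * ((1 + 1) * ‖v - w‖) := by gcongr
    _ = _ := by ring

theorem abs_crossIntensity_sub_le (n : ℕ) {x v w u : E} (hx : ‖x‖ = 1) (hu : ‖u‖ = 1) :
    |crossIntensity 𝕜 n x v u - crossIntensity 𝕜 n x w u| ≤ n * ‖v - w‖ := by
  rw [← crossIntensity_sub]
  unfold crossIntensity
  rw [abs_mul, Nat.abs_cast]
  gcongr
  refine (RCLike.abs_re_le_norm _).trans ?_
  rw [norm_mul]
  have h1 : ‖inner 𝕜 x u‖ ≤ 1 := by simpa [hu, hx] using norm_inner_le_norm (𝕜 := 𝕜) x u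
  have h2 : ‖inner 𝕜 u (v - w)‖ ≤ ‖v - w‖ := by
    simpa [hu] using norm_inner_le_norm (𝕜 := 𝕜) u (v - w)
  calc _ ≤ 1 * ‖v - w‖ := by gcongr
    _ = _ := one_mul _

theorem norm_I_smul (hI : RCLike.im (RCLike.I : 𝕜) = 1) (v : E) :
    ‖(RCLike.I : 𝕜) • v‖ = ‖v‖ := by
  have : (RCLike.I : 𝕜) ≠ 0 := fun h => by simp [h] at hI
  rw [norm_smul, RCLike.norm_I_of_ne_zero this, one_mul]

theorem crossIntensity_decompose (x v u : E) :
    crossIntensity 𝕜 n x v u = RCLike.re (inner 𝕜 x v) * scaledIntensity 𝕜 n x u +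
      crossIntensity 𝕜 n x (v - inner 𝕜 x v • x) u := by
  rw [← crossIntensity_smul_self, ← crossIntensity_add, add_sub_cancel]

theorem inner_sub_smul_self_eq_zero {x : E} (hx : ‖x‖ = 1) (v : E) :
    inner 𝕜 x (v - inner 𝕜 x v • x) = 0 := by
  rw [inner_sub_right, inner_smul_right, inner_self_eq_norm_sq_to_K, hx]
  simp

theorem exists_norm_eq_one_smul_eq {v : E} (hv : v ≠ 0) :
    ∃ w : E, ‖w‖ = 1 ∧ ((‖v‖ : ℝ) : 𝕜) • w = v := by
  have hv0 : (0 : ℝ) < ‖v‖ := norm_pos_iff.2 hv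
  refine ⟨((‖v‖⁻¹ : ℝ) : 𝕜) • v, ?_, ?_⟩
  · rw [norm_smul, RCLike.norm_ofReal, abs_of_pos (inv_pos.2 hv0), inv_mul_cancel₀ hv0.ne']
  · rw [smul_smul, ← RCLike.ofReal_mul, mul_inv_cancel₀ hv0.ne', RCLike.ofReal_one, one_smul]

end Intensity

/-! ### Moments of intensities in the real and complex models -/

section Moments

variable {𝕜 : Type*} [RCLike 𝕜] {E : Type*} [NormedAddCommGroup E] [InnerProductSpace 𝕜 E]
  [InnerProductSpace ℝ E] {n : ℕ}

/-- One formula serves both models: over ℝ the element `RCLike.I` is 0 and the second square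
disappears. -/
theorem IsRealification.norm_inner_sq (h : IsRealification 𝕜 E n) (v u : E) :
    ‖inner 𝕜 v u‖ ^ 2 = inner ℝ v u ^ 2 + inner ℝ ((RCLike.I : 𝕜) • v) u ^ 2 := by
  rw [h.inner_eq, h.inner_eq, inner_smul_left, RCLike.conj_I, neg_mul, map_neg, RCLike.I_mul_re,
    neg_neg, RCLike.norm_sq_eq_def]
  ring

theorem IsRealification.scaledIntensity_eq (h : IsRealification 𝕜 E n) (v u : E) :
    scaledIntensity 𝕜 n v u =
      n * (inner ℝ v u ^ 2 + inner ℝ ((RCLike.I : 𝕜) • v) u ^ 2) := by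
  rw [scaledIntensity, h.norm_inner_sq]

theorem IsRealification.inner_I_smul_self (h : IsRealification 𝕜 E n) (v : E) :
    inner ℝ v ((RCLike.I : 𝕜) • v) = 0 := by
  rw [h.inner_eq, inner_smul_right, RCLike.I_mul_re, inner_self_im, neg_zero]

theorem IsRealification.natCast_pos [FiniteDimensional ℝ E] [Nontrivial E]
    (h : IsRealification 𝕜 E n) : (0 : ℝ) < n := by
  have hpos : 0 < Module.finrank ℝ E := Module.finrank_pos
  have : 0 < n := by rcases h.finrank_eq with ⟨_, hN⟩ | ⟨_, hN⟩ <;> omega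
  exact_mod_cast this

variable [FiniteDimensional ℝ E] [MeasurableSpace E] [BorelSpace E]

/-- The reflection that negates v fixes x, because x is orthogonal to v, and it preserves the
uniform law. -/
theorem integral_eq_zero_of_odd [IsScalarTower ℝ 𝕜 E] {x v : E} (hxv : inner 𝕜 x v = 0)
    (F : 𝕜 → 𝕜 → ℝ) (hF : ∀ s t, F s (-t) = -F s t) :
    ∫ u, F (inner 𝕜 x u) (inner 𝕜 u v) ∂(sphereLaw E) = 0 := by
  let S := (𝕜 ∙ v)ᗮ.reflection
  let T : E ≃ₗᵢ[ℝ] E := ⟨S.toLinearEquiv.restrictScalars ℝ, S.norm_map⟩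
  have hT : ∀ u, T u = S u := fun _ => rfl
  have hSv : S v = -v := Submodule.reflection_orthogonalComplement_singleton_eq_neg v
  have hSx : S x = x := Submodule.reflection_mem_subspace_eq_self
    (Submodule.mem_orthogonal_singleton_iff_inner_left.2 hxv)
  have h1 : ∀ u, inner 𝕜 x (S u) = inner 𝕜 x u := fun u => by
    conv_lhs => rw [← hSx, S.inner_map_map]
  have h2 : ∀ u, inner 𝕜 (S u) v = -inner 𝕜 u v := fun u => by
    rw [← S.inner_map_map u v, hSv, inner_neg_right, neg_neg]
  have h3 := integral_sphereLaw_comp T (fun u => F (inner 𝕜 x u) (inner 𝕜 u v))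
  simp only [hT, h1, h2, hF, integral_neg] at h3
  linarith

variable [Nontrivial E]

/-- Over ℂ the real dimension is 2n, and n(p² + q²) is the mean of 2np² and 2nq²; the
arithmetic–geometric inequality then reduces to real coordinates. -/
theorem integral_exp_scaledIntensity_le (h : IsRealification 𝕜 E n) {v : E} (hv : ‖v‖ = 1) :
    ∫ u, Real.exp (1 / 16 * scaledIntensity 𝕜 n v u) ∂(sphereLaw E) ≤ expMomentBound := by
  simp only [h.scaledIntensity_eq]
  have h1 := integral_exp_inner_sq_le hv
  rcases h.finrank_eq with ⟨hI, hN⟩ | ⟨hI, hN⟩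
  · rw [hN] at h1
    simpa [hI] using h1
  · have h2 := integral_exp_inner_sq_le (e := (RCLike.I : 𝕜) • v) (by rw [norm_I_smul hI, hv])
    rw [hN] at h1 h2
    push_cast at h1 h2
    have hle : ∀ u : E, Real.exp (1 / 16 * (n * (inner ℝ v u ^ 2 +
        inner ℝ ((RCLike.I : 𝕜) • v) u ^ 2))) ≤
        1 / 2 * (Real.exp (1 / 16 * (2 * n * inner ℝ v u ^ 2)) +
          Real.exp (1 / 16 * (2 * n * inner ℝ ((RCLike.I : 𝕜) • v) u ^ 2))) := by
      intro u
      set p := inner ℝ v u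
      set q := inner ℝ ((RCLike.I : 𝕜) • v) u
      have e1 : Real.exp (1 / 16 * (n * (p ^ 2 + q ^ 2))) =
          Real.exp (1 / 16 * (n * p ^ 2)) * Real.exp (1 / 16 * (n * q ^ 2)) := by
        rw [← Real.exp_add]; congr 1; ring
      have e2 : ∀ p : ℝ, Real.exp (1 / 16 * (2 * n * p ^ 2)) =
          Real.exp (1 / 16 * (n * p ^ 2)) ^ 2 := fun p => by
        rw [← Real.exp_nat_mul]; congr 1; push_cast; ring
      rw [e1, e2, e2]
      nlinarith [sq_nonneg (Real.exp (1 / 16 * (n * p ^ 2)) - Real.exp (1 / 16 * (n * q ^ 2)))]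
    refine (integral_mono (integrable_sphereLaw (by fun_prop)) (integrable_sphereLaw (by fun_prop))
      hle).trans ?_
    rw [integral_const_mul, integral_add (integrable_sphereLaw (by fun_prop))
      (integrable_sphereLaw (by fun_prop))]
    linarith

theorem integral_scaledIntensity (h : IsRealification 𝕜 E n) {v : E} (hv : ‖v‖ = 1) :
    ∫ u, scaledIntensity 𝕜 n v u ∂(sphereLaw E) = 1 := by
  have hn := h.natCast_pos
  simp only [h.scaledIntensity_eq]
  rw [integral_const_mul, integral_add (integrable_sphereLaw (by fun_prop))
      (integrable_sphereLaw (by fun_prop)), integral_inner_sq_sphereLaw hv]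
  rcases h.finrank_eq with ⟨hI, hN⟩ | ⟨hI, hN⟩
  · rw [hN]
    simp only [hI, zero_smul, inner_zero_left]
    simp
    field_simp
  · rw [integral_inner_sq_sphereLaw (by rw [norm_I_smul hI, hv]), hN]
    push_cast
    field_simp
    norm_num

/-- This variance gap is what lets the certificate separate x from its orthogonal directions. Its
exact value is 2n/(n + 2) over ℝ and n/(n + 1) over ℂ; the latter equals 2/3 at n = 2. -/
theorem integral_scaledIntensity_sq_sub (h : IsRealification 𝕜 E n) (hn : 2 ≤ n) {x v : E}
    (hx : ‖x‖ = 1) (hv : ‖v‖ = 1) (hxv : inner 𝕜 x v = 0) :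
    2 / 3 ≤ ∫ u, scaledIntensity 𝕜 n x u ^ 2 ∂(sphereLaw E) -
      ∫ u, scaledIntensity 𝕜 n x u * scaledIntensity 𝕜 n v u ∂(sphereLaw E) := by
  have hn' : (2 : ℝ) ≤ n := by exact_mod_cast hn
  have hr : ∀ c d : 𝕜, inner ℝ (c • x) (d • v) = 0 := fun c d => by
    rw [h.inner_eq, inner_smul_left, inner_smul_right, hxv]; simp
  have hxv' : inner ℝ x v = 0 := by simpa using hr 1 1
  simp only [h.scaledIntensity_eq]
  rcases h.finrank_eq with ⟨hI, hN⟩ | ⟨hI, hN⟩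
  · have e1 : ∀ u : E, (n * (inner ℝ x u ^ 2 + inner ℝ ((RCLike.I : 𝕜) • x) u ^ 2)) ^ 2 =
        (n : ℝ) ^ 2 * inner ℝ x u ^ 4 := fun u => by simp [hI]; ring
    have e2 : ∀ u : E, n * (inner ℝ x u ^ 2 + inner ℝ ((RCLike.I : 𝕜) • x) u ^ 2) *
        (n * (inner ℝ v u ^ 2 + inner ℝ ((RCLike.I : 𝕜) • v) u ^ 2)) =
        (n : ℝ) ^ 2 * (inner ℝ x u ^ 2 * inner ℝ v u ^ 2) := fun u => by simp [hI]; ring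
    simp only [e1, e2]
    rw [integral_const_mul, integral_const_mul, integral_inner_pow_four_eq hx hv hxv',
      integral_inner_sq_mul_inner_sq hx hv hxv', hN]
    field_simp
    nlinarith
  · set x' := (RCLike.I : 𝕜) • x with hx'
    set v' := (RCLike.I : 𝕜) • v with hv'
    have nx' : ‖x'‖ = 1 := by rw [hx', norm_I_smul hI, hx]
    have nv' : ‖v'‖ = 1 := by rw [hv', norm_I_smul hI, hv]
    have hxx' : inner ℝ x x' = 0 := h.inner_I_smul_self x
    have hxv1 : inner ℝ x v' = 0 := by simpa using hr 1 RCLike.I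
    have hxv2 : inner ℝ x' v = 0 := by simpa using hr RCLike.I 1
    have hxv3 : inner ℝ x' v' = 0 := hr RCLike.I RCLike.I
    have e1 : ∀ u : E, (n * (inner ℝ x u ^ 2 + inner ℝ x' u ^ 2)) ^ 2 =
        (n : ℝ) ^ 2 * (inner ℝ x u ^ 4 + inner ℝ x' u ^ 4 +
          2 * (inner ℝ x u ^ 2 * inner ℝ x' u ^ 2)) := fun u => by ring
    have e2 : ∀ u : E, n * (inner ℝ x u ^ 2 + inner ℝ x' u ^ 2) *
        (n * (inner ℝ v u ^ 2 + inner ℝ v' u ^ 2)) =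
        (n : ℝ) ^ 2 * (inner ℝ x u ^ 2 * inner ℝ v u ^ 2 + inner ℝ x u ^ 2 * inner ℝ v' u ^ 2 +
          (inner ℝ x' u ^ 2 * inner ℝ v u ^ 2 + inner ℝ x' u ^ 2 * inner ℝ v' u ^ 2)) :=
      fun u => by ring
    have hi : ∀ {F : E → ℝ}, Continuous F → Integrable F (sphereLaw E) := integrable_sphereLaw
    simp only [e1, e2]
    rw [integral_const_mul, integral_const_mul, integral_add (hi (by fun_prop)) (hi (by fun_prop)),
      integral_add (hi (by fun_prop)) (hi (by fun_prop)), integral_const_mul,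
      integral_add (hi (by fun_prop)) (hi (by fun_prop)),
      integral_add (hi (by fun_prop)) (hi (by fun_prop)),
      integral_add (hi (by fun_prop)) (hi (by fun_prop)),
      integral_inner_pow_four_eq hx hv hxv', integral_inner_pow_four_eq nx' nv' hxv3,
      integral_inner_sq_mul_inner_sq hx nx' hxx', integral_inner_sq_mul_inner_sq hx hv hxv',
      integral_inner_sq_mul_inner_sq hx nv' hxv1, integral_inner_sq_mul_inner_sq nx' hv hxv2,
      integral_inner_sq_mul_inner_sq nx' nv' hxv3, hN]
    push_cast
    field_simp
    nlinarith

end Moments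

/-! ### The truncated dual certificate and its expectations -/

section Certificate

theorem two_le_expMomentBound : 2 ≤ expMomentBound := by
  unfold expMomentBound
  have h1 : 1 ≤ Real.exp (1 / 16) := Real.one_le_exp (by norm_num)
  have h2 : 0 < Real.exp (-(3 / 16)) := Real.exp_pos _
  have h3 : Real.exp (-(3 / 16)) < 1 := by rw [Real.exp_lt_one_iff]; norm_num
  have h4 : 1 ≤ (1 - Real.exp (-(3 / 16)))⁻¹ := (one_le_inv₀ (by linarith)).2 (by linarith)
  nlinarith

/-- The level at which intensities are truncated in the dual certificate. -/
noncomputable def truncLevel : ℝ := 18 * 16 ^ 3 * expMomentBound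

theorem one_le_truncLevel : 1 ≤ truncLevel := by
  unfold truncLevel
  linarith [two_le_expMomentBound]

/-- A lower bound for the mean modulus of the measurement of a tangent matrix. -/
noncomputable def tangentBound : ℝ := 1 / (2 * √(2 * (16 * 24 * 16 ^ 4 * expMomentBound)))

theorem tangentBound_pos : 0 < tangentBound := by
  have := two_le_expMomentBound
  unfold tangentBound
  positivity

variable (𝕜 : Type*) [RCLike 𝕜] {E : Type*} [NormedAddCommGroup E] [InnerProductSpace 𝕜 E]
  [InnerProductSpace ℝ E] [FiniteDimensional ℝ E] [MeasurableSpace E] [BorelSpace E]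

/-- The constant coefficient of the dual certificate, chosen so that the mean of the certificate
vanishes on the tangent space. -/
noncomputable def truncCenter (n : ℕ) (x : E) : ℝ :=
  ∫ u, min (scaledIntensity 𝕜 n x u) truncLevel * scaledIntensity 𝕜 n x u ∂(sphereLaw E)

/-- The coefficients of the dual certificate. -/
noncomputable def truncWeight (n : ℕ) (x u : E) : ℝ :=
  truncCenter 𝕜 n x - min (scaledIntensity 𝕜 n x u) truncLevel

variable {𝕜} {n : ℕ}

theorem continuous_truncWeight (x : E) : Continuous (truncWeight 𝕜 n x) :=
  continuous_const.sub ((continuous_scaledIntensity n x).min continuous_const)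

variable [Nontrivial E]

theorem integral_scaledIntensity_pow_le (h : IsRealification 𝕜 E n) {v : E} (hv : ‖v‖ = 1)
    (j : ℕ) : ∫ u, scaledIntensity 𝕜 n v u ^ j ∂(sphereLaw E) ≤
      j.factorial * 16 ^ j * expMomentBound := by
  have hc := continuous_scaledIntensity (𝕜 := 𝕜) n v
  calc ∫ u, scaledIntensity 𝕜 n v u ^ j ∂(sphereLaw E) ≤
      ∫ u, j.factorial * 16 ^ j * Real.exp (1 / 16 * scaledIntensity 𝕜 n v u) ∂(sphereLaw E) := by
        refine integral_mono (integrable_sphereLaw (by fun_prop))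
          (integrable_sphereLaw (by fun_prop)) fun u => ?_
        have h0 := scaledIntensity_nonneg (𝕜 := 𝕜) n v u
        have := Real.pow_div_factorial_le_exp (1 / 16 * scaledIntensity 𝕜 n v u) (by positivity) j
        rw [div_le_iff₀ (by positivity), mul_pow, div_pow, one_pow] at this
        have h16 : (0 : ℝ) < 16 ^ j := by positivity
        calc scaledIntensity 𝕜 n v u ^ j =
            16 ^ j * (1 / 16 ^ j * scaledIntensity 𝕜 n v u ^ j) := by field_simp
          _ ≤ 16 ^ j * (Real.exp (1 / 16 * scaledIntensity 𝕜 n v u) * j.factorial) := by gcongr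
          _ = _ := by ring
    _ ≤ _ := by
      rw [integral_const_mul]
      gcongr
      exact integral_exp_scaledIntensity_le h hv

theorem truncCenter_mem (h : IsRealification 𝕜 E n) {x : E} (hx : ‖x‖ = 1) :
    truncCenter 𝕜 n x ∈ Set.Icc 0 truncLevel := by
  have hM := one_le_truncLevel
  have hc := continuous_scaledIntensity (𝕜 := 𝕜) n x
  have h0 := scaledIntensity_nonneg (𝕜 := 𝕜) n x
  refine ⟨integral_nonneg fun u => ?_, ?_⟩
  · have := h0 u
    exact mul_nonneg (le_min this (by linarith)) this
  · calc truncCenter 𝕜 n x ≤ ∫ u, truncLevel * scaledIntensity 𝕜 n x u ∂(sphereLaw E) := by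
          refine integral_mono (integrable_sphereLaw (by fun_prop))
            (integrable_sphereLaw (by fun_prop)) fun u => ?_
          have := h0 u
          simp only
          gcongr
          exact min_le_right _ _
      _ = truncLevel := by rw [integral_const_mul, integral_scaledIntensity h hx, mul_one]

theorem abs_truncWeight_le (h : IsRealification 𝕜 E n) {x : E} (hx : ‖x‖ = 1) (u : E) :
    |truncWeight 𝕜 n x u| ≤ truncLevel := by
  obtain ⟨h1, h2⟩ := truncCenter_mem h hx
  have h3 := scaledIntensity_nonneg (𝕜 := 𝕜) n x u
  have hM := one_le_truncLevel
  have h4 : 0 ≤ min (scaledIntensity 𝕜 n x u) truncLevel := le_min h3 (by linarith)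
  have h5 : min (scaledIntensity 𝕜 n x u) truncLevel ≤ truncLevel := min_le_right _ _
  rw [truncWeight, abs_le]
  constructor <;> linarith

/-- With M the truncation level, min(w, M) ≥ w − w²/M, so truncation costs at most the third moment
divided by M. -/
theorem integral_scaledIntensity_sq_sub_le_truncCenter (h : IsRealification 𝕜 E n) {x : E}
    (hx : ‖x‖ = 1) :
    ∫ u, scaledIntensity 𝕜 n x u ^ 2 ∂(sphereLaw E) - 1 / 3 ≤ truncCenter 𝕜 n x := by
  have hM := one_le_truncLevel
  have hc := continuous_scaledIntensity (𝕜 := 𝕜) n x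
  have h3 := integral_scaledIntensity_pow_le h hx 3
  have h4 : ∫ u, (scaledIntensity 𝕜 n x u ^ 2 - truncLevel⁻¹ * scaledIntensity 𝕜 n x u ^ 3)
      ∂(sphereLaw E) ≤ truncCenter 𝕜 n x := by
    refine integral_mono (integrable_sphereLaw (by fun_prop))
      (integrable_sphereLaw (by fun_prop)) fun u => ?_
    have h0 := scaledIntensity_nonneg (𝕜 := 𝕜) n x u
    simp only
    set w := scaledIntensity 𝕜 n x u
    have hle : w - truncLevel⁻¹ * w ^ 2 ≤ min w truncLevel := by
      refine le_min (by have : 0 ≤ truncLevel⁻¹ * w ^ 2 := by positivity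
                        linarith) ?_
      rw [sub_le_iff_le_add, ← sub_le_iff_le_add', le_inv_mul_iff₀ (by linarith)]
      nlinarith [sq_nonneg (w - truncLevel)]
    calc _ = (w - truncLevel⁻¹ * w ^ 2) * w := by ring
      _ ≤ _ := by gcongr
  rw [integral_sub (integrable_sphereLaw (by fun_prop)) (integrable_sphereLaw (by fun_prop)),
    integral_const_mul] at h4
  have h5 : truncLevel⁻¹ * ∫ u, scaledIntensity 𝕜 n x u ^ 3 ∂(sphereLaw E) ≤ 1 / 3 := by
    rw [inv_mul_le_iff₀ (by linarith)]
    -- `truncLevel` is exactly three times the third-moment bound 3!·16³·`expMomentBound`.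
    refine h3.trans (le_of_eq ?_)
    rw [truncLevel]
    norm_num [Nat.factorial]
    ring
  linarith

/-- Truncation only raises the weight, so the gap 2/3 survives up to the loss 1/3 in the centre. -/
theorem one_third_le_integral_truncWeight_mul (h : IsRealification 𝕜 E n) (hn : 2 ≤ n) {x v : E}
    (hx : ‖x‖ = 1) (hv : ‖v‖ = 1) (hxv : inner 𝕜 x v = 0) :
    1 / 3 ≤ ∫ u, truncWeight 𝕜 n x u * scaledIntensity 𝕜 n v u ∂(sphereLaw E) := by
  have hcx := continuous_scaledIntensity (𝕜 := 𝕜) n x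
  have hcv := continuous_scaledIntensity (𝕜 := 𝕜) n v
  have h1 : ∫ u, (truncCenter 𝕜 n x * scaledIntensity 𝕜 n v u -
      scaledIntensity 𝕜 n x u * scaledIntensity 𝕜 n v u) ∂(sphereLaw E) ≤
      ∫ u, truncWeight 𝕜 n x u * scaledIntensity 𝕜 n v u ∂(sphereLaw E) := by
    refine integral_mono (integrable_sphereLaw (by fun_prop))
      (integrable_sphereLaw ((continuous_truncWeight x).mul hcv)) fun u => ?_
    have h0 := scaledIntensity_nonneg (𝕜 := 𝕜) n v u
    simp only [truncWeight, ← sub_mul]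
    gcongr
    exact min_le_left _ _
  rw [integral_sub (integrable_sphereLaw (by fun_prop)) (integrable_sphereLaw (by fun_prop)),
    integral_const_mul, integral_scaledIntensity h hv] at h1
  linarith [integral_scaledIntensity_sq_sub h hn hx hv hxv,
    integral_scaledIntensity_sq_sub_le_truncCenter h hx]

/-- The component along x vanishes by the choice of `truncCenter`, as the intensity has mean 1; the
orthogonal component vanishes by oddness. -/
theorem integral_truncWeight_mul_crossIntensity [IsScalarTower ℝ 𝕜 E] (h : IsRealification 𝕜 E n)
    {x : E} (hx : ‖x‖ = 1) (v : E) :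
    ∫ u, truncWeight 𝕜 n x u * crossIntensity 𝕜 n x v u ∂(sphereLaw E) = 0 := by
  have hcx := continuous_scaledIntensity (𝕜 := 𝕜) n x
  have hct := continuous_truncWeight (𝕜 := 𝕜) (n := n) x
  have hcc := continuous_crossIntensity (𝕜 := 𝕜) n x (v - inner 𝕜 x v • x)
  have h1 : ∫ u, truncWeight 𝕜 n x u * scaledIntensity 𝕜 n x u ∂(sphereLaw E) = 0 := by
    simp only [truncWeight, sub_mul]
    rw [integral_sub (integrable_sphereLaw (by fun_prop)) (integrable_sphereLaw (by fun_prop)),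
      integral_const_mul, integral_scaledIntensity h hx, mul_one, truncCenter, sub_self]
  have h2 : ∫ u, truncWeight 𝕜 n x u * crossIntensity 𝕜 n x (v - inner 𝕜 x v • x) u
      ∂(sphereLaw E) = 0 :=
    integral_eq_zero_of_odd (inner_sub_smul_self_eq_zero hx v)
      (fun s t => (truncCenter 𝕜 n x - min (n * ‖s‖ ^ 2) truncLevel) * (n * RCLike.re (s * t)))
      (fun s t => by rw [mul_neg, map_neg, mul_neg, mul_neg])
  simp only [crossIntensity_decompose x v, mul_add]
  rw [integral_add (integrable_sphereLaw (by fun_prop)) (integrable_sphereLaw (by fun_prop)), h2,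
    add_zero]
  simp only [mul_left_comm (truncWeight 𝕜 n x _)]
  rw [integral_const_mul, h1, mul_zero]

/-- Polarization: twice the cross intensity is the difference of the intensities along the
orthonormal pair (x ± v)/√2, and the variance gap applies to that pair in both orders. -/
theorem one_third_le_integral_crossIntensity_sq (h : IsRealification 𝕜 E n) (hn : 2 ≤ n) {x v : E}
    (hx : ‖x‖ = 1) (hv : ‖v‖ = 1) (hxv : inner 𝕜 x v = 0) :
    1 / 3 ≤ ∫ u, crossIntensity 𝕜 n x v u ^ 2 ∂(sphereLaw E) := by
  set r : 𝕜 := (((√2)⁻¹ : ℝ) : 𝕜) with hr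
  have hr2 : ‖r‖ ^ 2 = 1 / 2 := by
    rw [hr, RCLike.norm_ofReal, sq_abs, inv_pow, Real.sq_sqrt (by norm_num)]; norm_num
  have hvx : inner 𝕜 v x = 0 := inner_eq_zero_symm.1 hxv
  have hnorm : ∀ y : E, ‖y‖ ^ 2 = 2 → ‖r • y‖ = 1 := fun y hy => by
    rw [← sq_eq_sq₀ (norm_nonneg _) zero_le_one, norm_smul, mul_pow, hr2, hy]; norm_num
  have hpyth : ‖x + v‖ ^ 2 = 2 ∧ ‖x - v‖ ^ 2 = 2 := by
    rw [norm_add_sq (𝕜 := 𝕜), norm_sub_sq (𝕜 := 𝕜), hxv, hx, hv]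
    norm_num
  have hp := hnorm _ hpyth.1
  have hm := hnorm _ hpyth.2
  have hpm : inner 𝕜 (r • (x + v)) (r • (x - v)) = 0 := by
    rw [inner_smul_left, inner_smul_right, inner_add_left, inner_sub_right, inner_sub_right, hxv,
      hvx, inner_self_eq_norm_sq_to_K, inner_self_eq_norm_sq_to_K, hx, hv]
    simp
  have hid : ∀ u, 2 * crossIntensity 𝕜 n x v u = scaledIntensity 𝕜 n (r • (x + v)) u -
      scaledIntensity 𝕜 n (r • (x - v)) u := by
    intro u
    rw [scaledIntensity_smul, scaledIntensity_smul, hr2]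
    unfold scaledIntensity crossIntensity
    rw [inner_add_left, inner_sub_left, ← inner_conj_symm u v, @RCLike.norm_sq_eq_def 𝕜,
      @RCLike.norm_sq_eq_def 𝕜]
    simp only [map_add, map_sub, RCLike.mul_re, RCLike.conj_re, RCLike.conj_im]
    ring
  have hcp := continuous_scaledIntensity (𝕜 := 𝕜) n (r • (x + v))
  have hcm := continuous_scaledIntensity (𝕜 := 𝕜) n (r • (x - v))
  have h1 := integral_scaledIntensity_sq_sub h hn hp hm hpm
  have h2 := integral_scaledIntensity_sq_sub h hn hm hp (inner_eq_zero_symm.1 hpm)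
  have hexp : ∀ u, crossIntensity 𝕜 n x v u ^ 2 =
      1 / 4 * (scaledIntensity 𝕜 n (r • (x + v)) u ^ 2 + scaledIntensity 𝕜 n (r • (x - v)) u ^ 2 -
      (scaledIntensity 𝕜 n (r • (x + v)) u * scaledIntensity 𝕜 n (r • (x - v)) u +
      scaledIntensity 𝕜 n (r • (x - v)) u * scaledIntensity 𝕜 n (r • (x + v)) u)) := fun u => by
    linear_combination (1 / 4 * (2 * crossIntensity 𝕜 n x v u +
      (scaledIntensity 𝕜 n (r • (x + v)) u - scaledIntensity 𝕜 n (r • (x - v)) u))) * hid u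
  simp only [hexp]
  rw [integral_const_mul,
    integral_sub (integrable_sphereLaw (by fun_prop)) (integrable_sphereLaw (by fun_prop)),
    integral_add (integrable_sphereLaw (by fun_prop)) (integrable_sphereLaw (by fun_prop)),
    integral_add (integrable_sphereLaw (by fun_prop)) (integrable_sphereLaw (by fun_prop))]
  linarith

theorem norm_sq_le_three_mul_integral_crossIntensity_sq (h : IsRealification 𝕜 E n) (hn : 2 ≤ n)
    {x v : E} (hx : ‖x‖ = 1) (hxv : inner 𝕜 x v = 0) :
    ‖v‖ ^ 2 ≤ 3 * ∫ u, crossIntensity 𝕜 n x v u ^ 2 ∂(sphereLaw E) := by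
  rcases eq_or_ne v 0 with rfl | hv
  · simpa using integral_nonneg fun u => sq_nonneg (crossIntensity 𝕜 n x 0 u)
  obtain ⟨w, hw1, hvw⟩ := exists_norm_eq_one_smul_eq (𝕜 := 𝕜) hv
  have hxw : inner 𝕜 x w = 0 := by
    rw [← hvw, inner_smul_right] at hxv
    exact (mul_eq_zero.1 hxv).resolve_left (by simpa using hv)
  have h1 := one_third_le_integral_crossIntensity_sq h hn hx hw1 hxw
  have h2 : ∀ u, crossIntensity 𝕜 n x v u ^ 2 = ‖v‖ ^ 2 * crossIntensity 𝕜 n x w u ^ 2 :=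
    fun u => by
      conv_lhs => rw [← hvw, crossIntensity_ofReal_smul]
      ring
  simp only [h2]
  rw [integral_const_mul]
  nlinarith [sq_nonneg ‖v‖]

/-- With v = βx + v′, β real and v′ orthogonal to x, the mixed term is odd in v′. What remains is at
least 4β² + (4/3)‖v′‖², and β² + ‖v′‖² = 1. -/
theorem integral_two_mul_crossIntensity_sq [IsScalarTower ℝ 𝕜 E] (h : IsRealification 𝕜 E n)
    (hn : 2 ≤ n) {x v : E} (hx : ‖x‖ = 1) (hv : ‖v‖ = 1) (hxv : RCLike.im (inner 𝕜 x v) = 0) :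
    4 / 3 ≤ ∫ u, (2 * crossIntensity 𝕜 n x v u) ^ 2 ∂(sphereLaw E) := by
  set β := RCLike.re (inner 𝕜 x v) with hβ
  set v' := v - inner 𝕜 x v • x with hv'
  have hxv' : inner 𝕜 x v' = 0 := inner_sub_smul_self_eq_zero hx v
  have hcx := continuous_scaledIntensity (𝕜 := 𝕜) n x
  have hcc := continuous_crossIntensity (𝕜 := 𝕜) n x v'
  have hnorm : β ^ 2 + ‖v'‖ ^ 2 = 1 := by
    have hdec : v = inner 𝕜 x v • x + v' := by rw [hv']; abel
    have := norm_add_sq (𝕜 := 𝕜) (inner 𝕜 x v • x) v'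
    rw [← hdec, inner_smul_left, hxv', norm_smul, hx, hv, mul_one, RCLike.norm_sq_eq_def, hxv,
      ← hβ] at this
    simp at this
    linarith
  have h1 : ∫ u, scaledIntensity 𝕜 n x u * crossIntensity 𝕜 n x v' u ∂(sphereLaw E) = 0 :=
    integral_eq_zero_of_odd hxv' (fun s t => (n * ‖s‖ ^ 2) * (n * RCLike.re (s * t)))
      (fun s t => by rw [mul_neg, map_neg, mul_neg, mul_neg])
  have h2 : 1 ≤ ∫ u, scaledIntensity 𝕜 n x u ^ 2 ∂(sphereLaw E) := by
    have : ∫ u, (2 * scaledIntensity 𝕜 n x u - 1) ∂(sphereLaw E) ≤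
        ∫ u, scaledIntensity 𝕜 n x u ^ 2 ∂(sphereLaw E) :=
      integral_mono (integrable_sphereLaw (by fun_prop)) (integrable_sphereLaw (by fun_prop))
        fun u => by
          simp only
          nlinarith [sq_nonneg (scaledIntensity 𝕜 n x u - 1)]
    rw [integral_sub (integrable_sphereLaw (by fun_prop)) (integrable_sphereLaw (by fun_prop)),
      integral_const_mul, integral_scaledIntensity h hx] at this
    simp at this
    linarith
  have h3 := norm_sq_le_three_mul_integral_crossIntensity_sq h hn hx hxv'
  have hexp : ∀ u, (2 * crossIntensity 𝕜 n x v u) ^ 2 = 4 * β ^ 2 * scaledIntensity 𝕜 n x u ^ 2 +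
      8 * β * (scaledIntensity 𝕜 n x u * crossIntensity 𝕜 n x v' u) +
      4 * crossIntensity 𝕜 n x v' u ^ 2 := fun u => by
    rw [crossIntensity_decompose x v]; ring
  simp only [hexp]
  rw [integral_add (integrable_sphereLaw (by fun_prop)) (integrable_sphereLaw (by fun_prop)),
    integral_add (integrable_sphereLaw (by fun_prop)) (integrable_sphereLaw (by fun_prop)),
    integral_const_mul, integral_const_mul, integral_const_mul, h1]
  nlinarith [sq_nonneg β]

/-- A fourth-moment argument: y ≥ y²/R − y⁴/R³ for y ≥ 0. The second moment is at least 4/3 and the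
fourth at most C, so R² = 2C leaves at least 4/(3R) − 1/(2R) ≥ 1/(2R). -/
theorem tangentBound_le_integral [IsScalarTower ℝ 𝕜 E] (h : IsRealification 𝕜 E n)
    (hn : 2 ≤ n) {x v : E} (hx : ‖x‖ = 1) (hv : ‖v‖ = 1) (hxv : RCLike.im (inner 𝕜 x v) = 0) :
    tangentBound ≤ ∫ u, 2 * |crossIntensity 𝕜 n x v u| ∂(sphereLaw E) := by
  have hK := two_le_expMomentBound
  set C := 16 * 24 * 16 ^ 4 * expMomentBound with hC
  set R := √(2 * C) with hR
  have hC0 : 0 < C := by positivity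
  have hR0 : 0 < R := by positivity
  have hR2 : R ^ 2 = 2 * C := Real.sq_sqrt (by positivity)
  have hcx := continuous_scaledIntensity (𝕜 := 𝕜) n x
  have hcv := continuous_scaledIntensity (𝕜 := 𝕜) n v
  have hcc := continuous_crossIntensity (𝕜 := 𝕜) n x v
  have h2 := integral_two_mul_crossIntensity_sq h hn hx hv hxv
  have h4 : ∫ u, (2 * crossIntensity 𝕜 n x v u) ^ 4 ∂(sphereLaw E) ≤ C := by
    calc _ ≤ ∫ u, 8 * (scaledIntensity 𝕜 n x u ^ 4 + scaledIntensity 𝕜 n v u ^ 4)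
        ∂(sphereLaw E) := by
          refine integral_mono (integrable_sphereLaw (by fun_prop))
            (integrable_sphereLaw (by fun_prop)) fun u => ?_
          simp only
          have := two_mul_abs_crossIntensity_le (𝕜 := 𝕜) n x v u
          set p := scaledIntensity 𝕜 n x u
          set q := scaledIntensity 𝕜 n v u
          calc (2 * crossIntensity 𝕜 n x v u) ^ 4 = (2 * |crossIntensity 𝕜 n x v u|) ^ 4 := by
                rw [mul_pow, mul_pow, Even.pow_abs (by decide)]
            _ ≤ (p + q) ^ 4 := by gcongr
            _ ≤ 8 * (p ^ 4 + q ^ 4) := by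
                have e1 : (p + q) ^ 2 ≤ 2 * (p ^ 2 + q ^ 2) := by nlinarith [sq_nonneg (p - q)]
                have e2 : (p ^ 2 + q ^ 2) ^ 2 ≤ 2 * (p ^ 4 + q ^ 4) := by
                  nlinarith [sq_nonneg (p ^ 2 - q ^ 2)]
                calc (p + q) ^ 4 = ((p + q) ^ 2) ^ 2 := by ring
                  _ ≤ (2 * (p ^ 2 + q ^ 2)) ^ 2 := by gcongr
                  _ ≤ _ := by linarith
      _ ≤ C := by
        rw [integral_const_mul, integral_add (integrable_sphereLaw (by fun_prop))
          (integrable_sphereLaw (by fun_prop))]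
        have e1 := integral_scaledIntensity_pow_le h hx 4
        have e2 := integral_scaledIntensity_pow_le h hv 4
        norm_num [Nat.factorial] at e1 e2
        rw [hC]
        linarith
  have h5 : ∫ u, (R⁻¹ * (2 * crossIntensity 𝕜 n x v u) ^ 2 -
      (R ^ 3)⁻¹ * (2 * crossIntensity 𝕜 n x v u) ^ 4) ∂(sphereLaw E) ≤
      ∫ u, 2 * |crossIntensity 𝕜 n x v u| ∂(sphereLaw E) := by
    refine integral_mono (integrable_sphereLaw (by fun_prop))
      (integrable_sphereLaw (by fun_prop)) fun u => ?_
    simp only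
    have e1 : (2 * crossIntensity 𝕜 n x v u) ^ 2 = (2 * |crossIntensity 𝕜 n x v u|) ^ 2 := by
      rw [mul_pow, mul_pow, sq_abs]
    have e2 : (2 * crossIntensity 𝕜 n x v u) ^ 4 = (2 * |crossIntensity 𝕜 n x v u|) ^ 4 := by
      rw [mul_pow, mul_pow, Even.pow_abs (by decide)]
    rw [e1, e2]
    have hy0 : 0 ≤ 2 * |crossIntensity 𝕜 n x v u| := by positivity
    set y := 2 * |crossIntensity 𝕜 n x v u|
    have e3 : R⁻¹ * y ^ 2 - (R ^ 3)⁻¹ * y ^ 4 = (R ^ 3)⁻¹ * (y * (R ^ 2 * y - y ^ 3)) := by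
      field_simp
    rw [e3, inv_mul_le_iff₀ (by positivity), mul_comm (R ^ 3)]
    gcongr
    rcases le_total y R with hyR | hyR
    · have : R ^ 2 * y ≤ R ^ 2 * R := by gcongr
      have : 0 ≤ y ^ 3 := by positivity
      linarith
    · have : R ^ 2 * y ≤ y ^ 2 * y := by gcongr
      have : 0 < R ^ 3 := by positivity
      linarith
  rw [integral_sub (integrable_sphereLaw (by fun_prop)) (integrable_sphereLaw (by fun_prop)),
    integral_const_mul, integral_const_mul] at h5
  refine le_trans ?_ h5
  have e1 : R⁻¹ * (4 / 3) ≤ R⁻¹ * ∫ u, (2 * crossIntensity 𝕜 n x v u) ^ 2 ∂(sphereLaw E) := by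
    gcongr
  have e2 : (R ^ 3)⁻¹ * ∫ u, (2 * crossIntensity 𝕜 n x v u) ^ 4 ∂(sphereLaw E) ≤
      (R ^ 3)⁻¹ * (R ^ 2 / 2) := by
    gcongr
    linarith
  have e3 : (R ^ 3)⁻¹ * (R ^ 2 / 2) = R⁻¹ * (1 / 2) := by field_simp
  have e4 : tangentBound = R⁻¹ * (1 / 2) := by
    rw [tangentBound, ← hC, ← hR]; field_simp
  have : 0 < R⁻¹ := by positivity
  rw [e4]
  linarith

end Certificate

/-! ### Good samples: the deterministic argument and their probability -/

section GoodSample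

/-- The uniform bounds over all directions that make the truncated dual certificate at `x` work for
the sample `z`. -/
structure IsGoodSample (𝕜 : Type*) [RCLike 𝕜] {E : Type*} [NormedAddCommGroup E]
    [InnerProductSpace 𝕜 E] [InnerProductSpace ℝ E] [FiniteDimensional ℝ E] [MeasurableSpace E]
    [BorelSpace E] (n : ℕ) {m : ℕ} (ε : ℝ) (x : E) (z : Fin m → E) : Prop where
  tangent : ∀ v : E, ‖v‖ = 1 → RCLike.im (inner 𝕜 x v) = 0 →
    m * (tangentBound - 2 * ε) ≤ ∑ i, 2 * |crossIntensity 𝕜 n x v (z i)|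
  upper : ∀ v : E, ‖v‖ = 1 → ∑ i, scaledIntensity 𝕜 n v (z i) ≤ m * (1 + 2 * ε)
  normal : ∀ v : E, ‖v‖ = 1 → inner 𝕜 x v = 0 →
    m * (1 / 3 - 2 * ε) ≤ ∑ i, truncWeight 𝕜 n x (z i) * scaledIntensity 𝕜 n v (z i)
  dual : ∀ v : E, ‖v‖ = 1 →
    m * (-(2 * ε)) ≤ ∑ i, truncWeight 𝕜 n x (z i) * crossIntensity 𝕜 n x v (z i)

variable {𝕜 : Type*} [RCLike 𝕜] {E : Type*} [NormedAddCommGroup E] [InnerProductSpace 𝕜 E]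
  [InnerProductSpace ℝ E] [FiniteDimensional ℝ E] [MeasurableSpace E] [BorelSpace E]
  {n m : ℕ} {ε : ℝ} {x : E} {z : Fin m → E}

theorem IsGoodSample.tangent_mul_norm_le (hz : IsGoodSample 𝕜 n ε x z) {v : E}
    (hxv : RCLike.im (inner 𝕜 x v) = 0) :
    m * (tangentBound - 2 * ε) * ‖v‖ ≤ ∑ i, 2 * |crossIntensity 𝕜 n x v (z i)| := by
  rcases eq_or_ne v 0 with rfl | hv
  · simpa using Finset.sum_nonneg fun i _ => by positivity
  obtain ⟨w, hw1, hvw⟩ := exists_norm_eq_one_smul_eq (𝕜 := 𝕜) hv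
  have hxw : RCLike.im (inner 𝕜 x w) = 0 := by
    rw [← hvw, inner_smul_right, RCLike.im_ofReal_mul] at hxv
    exact (mul_eq_zero.1 hxv).resolve_left (norm_ne_zero_iff.2 hv)
  have h1 := mul_le_mul_of_nonneg_right (hz.tangent w hw1 hxw) (norm_nonneg v)
  refine h1.trans (le_of_eq ?_)
  conv_rhs => rw [← hvw]
  simp only [crossIntensity_ofReal_smul, abs_mul, abs_norm]
  rw [Finset.sum_mul]
  exact Finset.sum_congr rfl fun i _ => by ring

theorem IsGoodSample.dual_mul_norm_le (hz : IsGoodSample 𝕜 n ε x z) (v : E) :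
    m * (-(2 * ε)) * ‖v‖ ≤ ∑ i, truncWeight 𝕜 n x (z i) * crossIntensity 𝕜 n x v (z i) := by
  rcases eq_or_ne v 0 with rfl | hv
  · simp [crossIntensity]
  obtain ⟨w, hw1, hvw⟩ := exists_norm_eq_one_smul_eq (𝕜 := 𝕜) hv
  have h1 := mul_le_mul_of_nonneg_right (hz.dual w hw1) (norm_nonneg v)
  refine h1.trans (le_of_eq ?_)
  conv_rhs => rw [← hvw]
  simp only [crossIntensity_ofReal_smul]
  rw [Finset.sum_mul]
  exact Finset.sum_congr rfl fun i _ => by ring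

theorem IsGoodSample.le_upper_mul_norm_sq (hz : IsGoodSample 𝕜 n ε x z) (v : E) :
    ∑ i, scaledIntensity 𝕜 n v (z i) ≤ m * (1 + 2 * ε) * ‖v‖ ^ 2 := by
  rcases eq_or_ne v 0 with rfl | hv
  · simp [scaledIntensity]
  obtain ⟨w, hw1, hvw⟩ := exists_norm_eq_one_smul_eq (𝕜 := 𝕜) hv
  have h1 := mul_le_mul_of_nonneg_right (hz.upper w hw1) (sq_nonneg ‖v‖)
  refine le_trans (le_of_eq ?_) h1
  conv_lhs => rw [← hvw]
  simp only [scaledIntensity_smul, RCLike.norm_ofReal, abs_norm]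
  rw [Finset.sum_mul]
  exact Finset.sum_congr rfl fun i _ => by ring

theorem IsGoodSample.normal_mul_norm_sq_le (hz : IsGoodSample 𝕜 n ε x z) {v : E}
    (hxv : inner 𝕜 x v = 0) :
    m * (1 / 3 - 2 * ε) * ‖v‖ ^ 2 ≤
      ∑ i, truncWeight 𝕜 n x (z i) * scaledIntensity 𝕜 n v (z i) := by
  rcases eq_or_ne v 0 with rfl | hv
  · simp [scaledIntensity]
  obtain ⟨w, hw1, hvw⟩ := exists_norm_eq_one_smul_eq (𝕜 := 𝕜) hv
  have hxw : inner 𝕜 x w = 0 := by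
    rw [← hvw, inner_smul_right] at hxv
    exact (mul_eq_zero.1 hxv).resolve_left (by simpa using hv)
  have h1 := mul_le_mul_of_nonneg_right (hz.normal w hw1 hxw) (sq_nonneg ‖v‖)
  refine h1.trans (le_of_eq ?_)
  conv_rhs => rw [← hvw]
  simp only [scaledIntensity_smul, RCLike.norm_ofReal, abs_norm]
  rw [Finset.sum_mul]
  exact Finset.sum_congr rfl fun i _ => by ring

/-- The certificate gives T ≤ 16ε‖h‖, and the tangent bound gives 62ε‖h‖ ≤ 2T because `tangentBound`
is at least 64ε. Together 62ε‖h‖ ≤ 32ε‖h‖. -/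
theorem IsGoodSample.eq_zero_of_measurements_eq_zero (hz : IsGoodSample 𝕜 n ε x z) (hm : 0 < m)
    (hε : 0 < ε) (hε1 : ε ≤ tangentBound / 64) (hε2 : ε ≤ 1 / 24) {ι : Type*} [Fintype ι]
    {h : E} (hxh : RCLike.im (inner 𝕜 x h) = 0) {c : ι → E} (hxc : ∀ k, inner 𝕜 x (c k) = 0)
    (hzero : ∀ i, 2 * crossIntensity 𝕜 n x h (z i) + ∑ k, scaledIntensity 𝕜 n (c k) (z i) = 0) :
    h = 0 ∧ ∀ k, c k = 0 := by
  have hm' : (0 : ℝ) < m := by exact_mod_cast hm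
  set T := ∑ k, ‖c k‖ ^ 2 with hT
  have hT0 : 0 ≤ T := Finset.sum_nonneg fun k _ => by positivity
  have h1 : m * (1 / 3 - 2 * ε) * T ≤
      ∑ i, truncWeight 𝕜 n x (z i) * ∑ k, scaledIntensity 𝕜 n (c k) (z i) := by
    simp only [Finset.mul_sum]
    rw [Finset.sum_comm, hT, Finset.mul_sum]
    exact Finset.sum_le_sum fun k _ => hz.normal_mul_norm_sq_le (hxc k)
  have h2 := hz.dual_mul_norm_le h
  have h3 : ∑ i, truncWeight 𝕜 n x (z i) * ∑ k, scaledIntensity 𝕜 n (c k) (z i) =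
      -(2 * ∑ i, truncWeight 𝕜 n x (z i) * crossIntensity 𝕜 n x h (z i)) := by
    rw [Finset.mul_sum, ← Finset.sum_neg_distrib]
    exact Finset.sum_congr rfl fun i _ => by
      linear_combination truncWeight 𝕜 n x (z i) * hzero i
  have h4 : m * T ≤ m * (16 * ε * ‖h‖) := by
    have : m * (1 / 4) * T ≤ m * (1 / 3 - 2 * ε) * T := by gcongr; linarith
    linarith
  have h5 := le_of_mul_le_mul_left h4 hm'
  -- The normal part has nonnegative measurements, so the modulus of each tangent measurement equals
  -- the normal one without loss.
  have h6 : ∑ i, 2 * |crossIntensity 𝕜 n x h (z i)| =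
      ∑ i, ∑ k, scaledIntensity 𝕜 n (c k) (z i) := by
    refine Finset.sum_congr rfl fun i _ => ?_
    have hnn : 0 ≤ ∑ k, scaledIntensity 𝕜 n (c k) (z i) :=
      Finset.sum_nonneg fun k _ => scaledIntensity_nonneg _ _ _
    rw [abs_of_nonpos (by linarith [hzero i])]
    linarith [hzero i]
  have h7 : ∑ i, ∑ k, scaledIntensity 𝕜 n (c k) (z i) ≤ m * (1 + 2 * ε) * T := by
    rw [Finset.sum_comm, hT, Finset.mul_sum]
    exact Finset.sum_le_sum fun k _ => hz.le_upper_mul_norm_sq (c k)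
  have h8 := hz.tangent_mul_norm_le hxh
  have h9 : m * ((tangentBound - 2 * ε) * ‖h‖) ≤ m * (2 * T) := by
    have : m * (1 + 2 * ε) * T ≤ m * 2 * T := by gcongr; linarith
    linarith
  have h10 := le_of_mul_le_mul_left h9 hm'
  have h11 : 62 * ε * ‖h‖ ≤ (tangentBound - 2 * ε) * ‖h‖ := by gcongr; linarith
  have h12 : ‖h‖ = 0 := by
    have := norm_nonneg h
    by_contra hne
    have hpos : 0 < ‖h‖ := lt_of_le_of_ne this (Ne.symm hne)
    nlinarith [mul_pos hε hpos]
  have hTz : T = 0 := by rw [h12] at h5; linarith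
  refine ⟨norm_eq_zero.1 h12, fun k => ?_⟩
  have := (Finset.sum_eq_zero_iff_of_nonneg fun k _ => by positivity).1 hTz k (Finset.mem_univ k)
  simpa using this

variable [Nontrivial E] {Ω : Type*} [MeasurableSpace Ω] {P : Measure Ω} [IsProbabilityMeasure P]
  {Z : Fin m → Ω → Metric.sphere (0 : E) 1}

/-- The margin 2ε is split evenly between the deviation at net points and the passage to the whole
family. With t = 1/16 in `integral_exp_neg_mul_le`, the bound 1/64 is t/4 and 8192 is 32/t². -/
theorem measure_exists_sum_lt_le_of_abs_le (h : IsRealification 𝕜 E n) (hind : iIndepFun Z P)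
    (hlaw : ∀ i, HasLaw (Z i) (uniformSphere E) P) (hx : ‖x‖ = 1) {A : Set E}
    (hA : ∀ v ∈ A, ‖v‖ = 1) {f : E → E → ℝ} (hf : ∀ v ∈ A, Continuous (f v)) {D s a : ℝ}
    (hD : 0 ≤ D)
    (hfL : ∀ v ∈ A, ∀ w ∈ A, ∀ u, ‖u‖ = 1 → |f v u - f w u| ≤ 2 * n * D * ‖v - w‖)
    (hfb : ∀ v ∈ A, ∀ u, |f v u| ≤ D * (scaledIntensity 𝕜 n x u + scaledIntensity 𝕜 n v u))
    (hfa : ∀ v ∈ A, a ≤ ∫ u, f v u ∂(sphereLaw E)) (hs : 0 ≤ s) (hsD : s * D ≤ 1 / 64)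
    (hsK : s * (D ^ 2 * 8192 * expMomentBound) ≤ ε / 2) {k : ℕ} (hk : 0 < k)
    (hkε : 2 * n * D * (2 * (2 * n / k)) ≤ ε) :
    P.real {ω | ∃ v ∈ A, ∑ i, f v (Z i ω) < m * (a - 2 * ε)} ≤
      (2 * k + 1) ^ (2 * n) * Real.exp (-(s * ε / 2 * m)) := by
  have hexp : ∀ v ∈ A, ∫ u, Real.exp (-(s * f v u)) ∂(sphereLaw E) ≤
      Real.exp (-(s * (a - ε)) - s * ε / 2) := by
    intro v hv
    have hcx := continuous_scaledIntensity (𝕜 := 𝕜) n x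
    have hcv := continuous_scaledIntensity (𝕜 := 𝕜) n v
    refine (integral_exp_neg_mul_le (t := 1 / 16) (D := D) (by norm_num) hs (by linarith)
      (scaledIntensity_nonneg (𝕜 := 𝕜) n x) (scaledIntensity_nonneg (𝕜 := 𝕜) n v)
      (Filter.Eventually.of_forall (hfb v hv)) (integrable_sphereLaw (hf v hv))
      (integrable_sphereLaw (by fun_prop)) (integrable_sphereLaw (by fun_prop))
      (integral_exp_scaledIntensity_le h hx) (integral_exp_scaledIntensity_le h (hA v hv))
      (hfa v hv)).trans ?_
    rw [Real.exp_le_exp]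
    have := mul_le_mul_of_nonneg_left hsK hs
    norm_num
    linarith
  have hN : Module.finrank ℝ E ≤ 2 * n := by
    rcases h.finrank_eq with ⟨_, hN⟩ | ⟨_, hN⟩ <;> omega
  have hmain := measure_exists_sum_lt_le hind hlaw (fun v hv => (hA v hv).le) hf
    (L := 2 * n * D) (by positivity) hfL hs hexp hk
  refine le_trans (measureReal_mono ?_ (measure_ne_top _ _)) (hmain.trans ?_)
  · rintro ω ⟨v, hv, hlt⟩
    refine ⟨v, hv, hlt.trans_le ?_⟩
    have : 2 * n * D * (2 * (Module.finrank ℝ E / k)) ≤ 2 * n * D * (2 * (2 * n / k)) := by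
      gcongr
      exact_mod_cast hN
    exact mul_le_mul_of_nonneg_left (by linarith) (Nat.cast_nonneg m)
  · gcongr
    have : (0 : ℝ) ≤ k := by positivity
    linarith

theorem measure_not_isGoodSample_le [IsScalarTower ℝ 𝕜 E] (h : IsRealification 𝕜 E n)
    (hn : 2 ≤ n) (hind : iIndepFun Z P) (hlaw : ∀ i, HasLaw (Z i) (uniformSphere E) P)
    (hx : ‖x‖ = 1) {s : ℝ} (hs : 0 ≤ s) (hsD : s * truncLevel ≤ 1 / 64)
    (hsK : s * (truncLevel ^ 2 * 8192 * expMomentBound) ≤ ε / 2) {k : ℕ} (hk : 0 < k)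
    (hkε : 2 * n * truncLevel * (2 * (2 * n / k)) ≤ ε) :
    P.real {ω | ¬ IsGoodSample 𝕜 n ε x (fun i => (Z i ω : E))} ≤
      4 * ((2 * k + 1) ^ (2 * n) * Real.exp (-(s * ε / 2 * m))) := by
  have hM := one_le_truncLevel
  have hM0 : 0 ≤ truncLevel := by linarith
  have hnn := scaledIntensity_nonneg (𝕜 := 𝕜) (E := E) n
  have hwb := abs_truncWeight_le h hx
  have B1 := measure_exists_sum_lt_le_of_abs_le (ε := ε) h hind hlaw hx
    (A := {v | ‖v‖ = 1 ∧ RCLike.im (inner 𝕜 x v) = 0}) (fun v hv => hv.1)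
    (f := fun v u => 2 * |crossIntensity 𝕜 n x v u|)
    (fun v _ => continuous_const.mul (continuous_crossIntensity n x v).abs) (a := tangentBound)
    hM0 (fun v _ w _ u hu => by
      rw [← mul_sub, abs_mul, abs_two]
      have h1 := (abs_abs_sub_abs_le _ _).trans
        (abs_crossIntensity_sub_le (𝕜 := 𝕜) n (v := v) (w := w) hx hu)
      have h2 : (n : ℝ) * ‖v - w‖ * 1 ≤ n * ‖v - w‖ * truncLevel := by gcongr
      linarith)
    (fun v _ u => by
      rw [abs_mul, abs_two, abs_abs]
      exact (two_mul_abs_crossIntensity_le n x v u).trans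
        (le_mul_of_one_le_left (add_nonneg (hnn x u) (hnn v u)) hM))
    (fun v hv => tangentBound_le_integral h hn hx hv.1 hv.2) hs hsD hsK hk hkε
  -- The upper bound is treated as a lower bound for the negated intensity, of mean −1.
  have B2 := measure_exists_sum_lt_le_of_abs_le (ε := ε) h hind hlaw hx
    (A := {v | ‖v‖ = 1}) (fun v hv => hv) (f := fun v u => -scaledIntensity 𝕜 n v u)
    (fun v _ => (continuous_scaledIntensity n v).neg) (a := -1) hM0
    (fun v hv w hw u hu => by
      rw [neg_sub_neg, abs_sub_comm]
      refine (abs_scaledIntensity_sub_le n hv hw hu).trans ?_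
      have h2 : (n : ℝ) * ‖v - w‖ * 1 ≤ n * ‖v - w‖ * truncLevel := by gcongr
      linarith)
    (fun v _ u => by
      rw [abs_neg, abs_of_nonneg (hnn v u)]
      refine le_trans ?_ (le_mul_of_one_le_left (add_nonneg (hnn x u) (hnn v u)) hM)
      linarith [hnn x u])
    (fun v hv => by rw [integral_neg, integral_scaledIntensity h hv]) hs hsD hsK hk hkε
  have B3 := measure_exists_sum_lt_le_of_abs_le (ε := ε) h hind hlaw hx
    (A := {v | ‖v‖ = 1 ∧ inner 𝕜 x v = 0}) (fun v hv => hv.1)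
    (f := fun v u => truncWeight 𝕜 n x u * scaledIntensity 𝕜 n v u)
    (fun v _ => (continuous_truncWeight x).mul (continuous_scaledIntensity n v)) (a := 1 / 3) hM0
    (fun v hv w hw u hu => by
      rw [← mul_sub, abs_mul]
      calc _ ≤ truncLevel * (2 * n * ‖v - w‖) := by
            gcongr
            · exact hwb u
            · exact abs_scaledIntensity_sub_le n hv.1 hw.1 hu
        _ = _ := by ring)
    (fun v _ u => by
      rw [abs_mul, abs_of_nonneg (hnn v u)]
      gcongr
      · exact hnn v u
      · exact hwb u
      · linarith [hnn x u])
    (fun v hv => one_third_le_integral_truncWeight_mul h hn hx hv.1 hv.2) hs hsD hsK hk hkε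
  have B4 := measure_exists_sum_lt_le_of_abs_le (ε := ε) h hind hlaw hx
    (A := {v | ‖v‖ = 1}) (fun v hv => hv)
    (f := fun v u => truncWeight 𝕜 n x u * crossIntensity 𝕜 n x v u)
    (fun v _ => (continuous_truncWeight x).mul (continuous_crossIntensity n x v)) (a := 0) hM0
    (fun v hv w hw u hu => by
      rw [← mul_sub, abs_mul]
      calc _ ≤ truncLevel * (n * ‖v - w‖) := by
            gcongr
            · exact hwb u
            · exact abs_crossIntensity_sub_le n hx hu
        _ ≤ truncLevel * (2 * (n * ‖v - w‖)) := by
            have : 0 ≤ (n : ℝ) * ‖v - w‖ := by positivity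
            exact mul_le_mul_of_nonneg_left (by linarith) hM0
        _ = _ := by ring)
    (fun v _ u => by
      rw [abs_mul]
      have h1 := two_mul_abs_crossIntensity_le (𝕜 := 𝕜) n x v u
      have h2 := abs_nonneg (crossIntensity 𝕜 n x v u)
      gcongr
      · exact hwb u
      · linarith)
    (fun v hv => (integral_truncWeight_mul_crossIntensity h hx v).ge) hs hsD hsK hk hkε
  set b := (2 * (k : ℝ) + 1) ^ (2 * n) * Real.exp (-(s * ε / 2 * m))
  refine le_trans (measureReal_mono (s₂ := _ ∪ (_ ∪ (_ ∪ _))) ?_ (measure_ne_top _ _))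
    ((measureReal_union_le _ _).trans (le_trans (add_le_add B1 ((measureReal_union_le _ _).trans
      (add_le_add B2 ((measureReal_union_le _ _).trans (add_le_add B3 B4))))) (by linarith)))
  intro ω hω
  by_contra hcon
  simp only [Set.mem_union, not_or, Set.mem_ofPred_eq, not_exists, not_and, not_lt] at hcon hω
  obtain ⟨c1, c2, c3, c4⟩ := hcon
  refine hω ⟨fun v hv hxv => c1 v ⟨hv, hxv⟩, fun v hv => ?_, fun v hv hxv => c3 v ⟨hv, hxv⟩,
    fun v hv => ?_⟩
  · have := c2 v hv
    rw [Finset.sum_neg_distrib] at this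
    linarith
  · have := c4 v hv
    linarith

end GoodSample

/-! ### From injectivity to exact recovery -/

section Recovery

variable {𝕜 : Type*} [RCLike 𝕜] {n m : ℕ}

/-- Only the zero matrix is both annihilated by the measurements along `z` and the sum of a tangent
matrix `e h* + h e*` and a positive semidefinite matrix `∑ cₖ cₖ*` with range orthogonal to `e`. -/
def TangentInjective (𝕜 : Type*) [RCLike 𝕜] {E : Type*} [NormedAddCommGroup E]
    [InnerProductSpace 𝕜 E] (n : ℕ) {m : ℕ} (e : E) (z : Fin m → E) : Prop :=
  ∀ (h : E) (c : Fin n → E), RCLike.im (inner 𝕜 e h) = 0 → (∀ k, inner 𝕜 e (c k) = 0) →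
    (∀ i, 2 * crossIntensity 𝕜 n e h (z i) + ∑ k, scaledIntensity 𝕜 n (c k) (z i) = 0) →
    h = 0 ∧ ∀ k, c k = 0

theorem feasible_lift (z : Fin m → EuclideanSpace 𝕜 (Fin n)) (x : EuclideanSpace 𝕜 (Fin n)) :
    Feasible z (intensities z x) (lift x) := by
  refine ⟨funext fun i => ?_, Matrix.posSemidef_vecMulVec_self_star _⟩
  rw [measurementMap, intensities, lift, Matrix.vecMulVec_mulVec, dotProduct_smul,
    op_smul_eq_mul, dotProduct_comm (star _) x.ofLp, dotProduct_comm (star _) (z i).ofLp,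
    ← EuclideanSpace.inner_eq_star_dotProduct, ← EuclideanSpace.inner_eq_star_dotProduct,
    ← inner_conj_symm (z i) x, RCLike.conj_mul, ← RCLike.ofReal_pow, RCLike.ofReal_re]

open scoped MatrixOrder Matrix.Norms.L2Operator in
theorem exists_eq_conjTranspose_mul_self {X : Matrix (Fin n) (Fin n) 𝕜} (hX : X.PosSemidef) :
    ∃ B : Matrix (Fin n) (Fin n) 𝕜, X = B.conjTranspose * B :=
  CStarAlgebra.nonneg_iff_eq_star_mul_self.1 hX.nonneg

theorem re_dotProduct_conjTranspose_mul_self_mulVec (B : Matrix (Fin n) (Fin n) 𝕜)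
    (z : EuclideanSpace 𝕜 (Fin n)) :
    RCLike.re (star z.ofLp ⬝ᵥ (Matrix.mulVec (B.conjTranspose * B) z.ofLp)) =
      ∑ k, ‖inner 𝕜 (WithLp.toLp 2 (star (B k)) : EuclideanSpace 𝕜 (Fin n)) z‖ ^ 2 := by
  rw [← Matrix.mulVec_mulVec, Matrix.dotProduct_mulVec, ← Matrix.star_mulVec, dotProduct, map_sum]
  refine Finset.sum_congr rfl fun k _ => ?_
  rw [EuclideanSpace.inner_eq_star_dotProduct]
  simp only [star_star, Pi.star_apply, RCLike.star_def, RCLike.conj_mul]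
  rw [← RCLike.ofReal_pow, RCLike.ofReal_re, dotProduct_comm]
  rfl

/-- With yₖ = ηₖe + cₖ, the terms ηₖ e cₖ* and their adjoints go into h, and the multiple ∑|ηₖ|² − ρ
of ee* is shared equally between eh* and he*; hence the division by 2. -/
theorem sum_norm_inner_sq_sub {E : Type*} [NormedAddCommGroup E] [InnerProductSpace 𝕜 E]
    {ι : Type*} [Fintype ι] (e z : E) (y : ι → E) (ρ : ℝ) :
    n * (∑ k, ‖inner 𝕜 (y k) z‖ ^ 2 - ρ * ‖inner 𝕜 e z‖ ^ 2) =
      2 * crossIntensity 𝕜 n e (∑ k, (starRingEnd 𝕜 (inner 𝕜 e (y k))) •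
        (y k - inner 𝕜 e (y k) • e) +
        (((∑ k, ‖inner 𝕜 e (y k)‖ ^ 2 - ρ) / 2 : ℝ) : 𝕜) • e) z +
      ∑ k, scaledIntensity 𝕜 n (y k - inner 𝕜 e (y k) • e) z := by
  have hk : ∀ k, ‖inner 𝕜 (y k) z‖ ^ 2 = ‖inner 𝕜 e (y k)‖ ^ 2 * ‖inner 𝕜 e z‖ ^ 2 +
      2 * RCLike.re (inner 𝕜 e z * inner 𝕜 z ((starRingEnd 𝕜 (inner 𝕜 e (y k))) •
        (y k - inner 𝕜 e (y k) • e))) + ‖inner 𝕜 (y k - inner 𝕜 e (y k) • e) z‖ ^ 2 := by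
    intro k
    set η := inner 𝕜 e (y k)
    set c := y k - η • e with hc
    have hy : y k = η • e + c := by rw [hc]; abel
    rw [hy, inner_add_left, inner_smul_left, inner_smul_right, ← inner_conj_symm z c]
    simp only [@RCLike.norm_sq_eq_def 𝕜, map_add, RCLike.mul_re, RCLike.mul_im, RCLike.conj_re,
      RCLike.conj_im]
    ring
  rw [crossIntensity_add, crossIntensity_smul_self, RCLike.ofReal_re]
  simp only [hk, Finset.sum_add_distrib, ← Finset.sum_mul, ← Finset.mul_sum]
  simp only [scaledIntensity, crossIntensity, inner_sum, Finset.mul_sum, map_sum]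
  simp only [← Finset.mul_sum]
  ring

theorem TangentInjective.exactRecovery {z : Fin m → EuclideanSpace 𝕜 (Fin n)}
    {x e : EuclideanSpace 𝕜 (Fin n)} (he : ‖e‖ = 1) (hx : x = ((‖x‖ : ℝ) : 𝕜) • e)
    (hinj : TangentInjective 𝕜 n e z) :
    ExactRecovery z x := by
  have hunique : ∀ X, Feasible z (intensities z x) X → X = lift x := by
    rintro X ⟨hX, hpsd⟩
    obtain ⟨B, rfl⟩ := exists_eq_conjTranspose_mul_self hpsd
    set y : Fin n → EuclideanSpace 𝕜 (Fin n) := fun k => WithLp.toLp 2 (star (B k)) with hy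
    have hzero := hinj _ (fun k => y k - inner 𝕜 e (y k) • e) ?_
      (fun k => inner_sub_smul_self_eq_zero he (y k))
      (fun i => by
        rw [← sum_norm_inner_sq_sub e (z i) y (‖x‖ ^ 2)]
        have h1 := congrFun hX i
        rw [measurementMap, re_dotProduct_conjTranspose_mul_self_mulVec, intensities] at h1
        conv_rhs at h1 => rw [hx, inner_smul_left, norm_mul, RCLike.norm_conj, RCLike.norm_ofReal,
          abs_norm, mul_pow]
        rw [h1, sub_self, mul_zero])
    · obtain ⟨h1, h2⟩ := hzero
      -- Once all cₖ vanish, h is only the multiple of e, so h = 0 says that the norms agree.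
      have hsum : ∑ k, ‖inner 𝕜 e (y k)‖ ^ 2 = ‖x‖ ^ 2 := by
        simp only [h2, smul_zero, Finset.sum_const_zero, zero_add] at h1
        have he0 : e ≠ 0 := norm_ne_zero_iff.1 (by rw [he]; exact one_ne_zero)
        have h3 := (smul_eq_zero.1 h1).resolve_right he0
        have h4 : (∑ k, ‖inner 𝕜 e (y k)‖ ^ 2 - ‖x‖ ^ 2) / 2 = 0 := by exact_mod_cast h3
        linarith
      have hBk : ∀ k j, B k j = star (inner 𝕜 e (y k) * e.ofLp j) := by
        intro k j
        have h3 : y k = inner 𝕜 e (y k) • e := sub_eq_zero.1 (h2 k)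
        have h4 : (y k).ofLp j = star (B k j) := rfl
        rw [← star_star (B k j), ← h4]
        conv_lhs => rw [h3]
        rfl
      ext i j
      have hxi : ∀ i, x.ofLp i = ((‖x‖ : ℝ) : 𝕜) * e.ofLp i := fun i => by
        conv_lhs => rw [hx]
        rfl
      rw [Matrix.mul_apply, lift, Matrix.vecMulVec_apply, Pi.star_apply, hxi i, hxi j]
      simp only [Matrix.conjTranspose_apply, hBk, star_star]
      have h5 : ∀ k, inner 𝕜 e (y k) * e.ofLp i * star (inner 𝕜 e (y k) * e.ofLp j) =
          ((‖inner 𝕜 e (y k)‖ ^ 2 : ℝ) : 𝕜) * (e.ofLp i * star (e.ofLp j)) := fun k => by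
        rw [star_mul', RCLike.ofReal_pow, ← RCLike.mul_conj, ← RCLike.star_def]
        ring
      rw [Finset.sum_congr rfl fun k _ => h5 k, ← Finset.sum_mul, ← RCLike.ofReal_sum, hsum,
        star_mul', RCLike.star_def, RCLike.conj_ofReal, RCLike.ofReal_pow]
      ring
    · rw [inner_add_right, inner_sum, map_add, map_sum]
      have h3 : ∀ k, inner 𝕜 e (starRingEnd 𝕜 (inner 𝕜 e (y k)) •
          (y k - inner 𝕜 e (y k) • e)) = 0 := fun k => by
        rw [inner_smul_right, inner_sub_smul_self_eq_zero he, mul_zero]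
      simp only [h3, map_zero, Finset.sum_const_zero, zero_add]
      rw [inner_smul_right, RCLike.im_ofReal_mul, inner_self_im, mul_zero]
  intro X
  constructor
  · exact fun hX => hunique X hX.1
  · rintro rfl
    refine ⟨feasible_lift z x, fun X' hX' => ?_⟩
    rw [hunique X' hX']

/-- For x = 0 any direction serves, so the argument at a unit vector covers the zero signal too. -/
theorem exists_norm_eq_one_eq_norm_smul [NeZero n] (x : EuclideanSpace 𝕜 (Fin n)) :
    ∃ e : EuclideanSpace 𝕜 (Fin n), ‖e‖ = 1 ∧ x = ((‖x‖ : ℝ) : 𝕜) • e := by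
  rcases eq_or_ne x 0 with rfl | hx
  · exact ⟨EuclideanSpace.single 0 1, by simp, by simp⟩
  · obtain ⟨e, he, h⟩ := exists_norm_eq_one_smul_eq (𝕜 := 𝕜) hx
    exact ⟨e, he, h.symm⟩

/-- Here log n = 0 gives no lower bound on m and the moment estimates, which assume n ≥ 2, are
unavailable. But nothing nonzero is orthogonal to e, and a single measurement determines the real
scalar left in h. -/
theorem tangentInjective_of_dimension_one (hm : 0 < m) {e : EuclideanSpace 𝕜 (Fin 1)}
    (he : ‖e‖ = 1) {z : Fin m → EuclideanSpace 𝕜 (Fin 1)} (hz : ∀ i, ‖z i‖ = 1) :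
    TangentInjective 𝕜 1 e z := by
  have hperp : ∀ c : EuclideanSpace 𝕜 (Fin 1), inner 𝕜 e c = 0 → c = 0 := by
    intro c hc
    have he0 : e.ofLp 0 ≠ 0 := fun h0 => by
      have : e = 0 := by ext i; rw [Subsingleton.elim i 0]; simpa using h0
      simp [this] at he
    rw [EuclideanSpace.inner_eq_star_dotProduct] at hc
    ext i
    rw [Subsingleton.elim i 0]
    simpa [dotProduct, he0] using hc
  intro h c hh hc hzero
  have hc0 : ∀ k, c k = 0 := fun k => hperp _ (hc k)
  have heq : h = inner 𝕜 e h • e := sub_eq_zero.1 (hperp _ (inner_sub_smul_self_eq_zero he h))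
  have hze : inner 𝕜 e (z ⟨0, hm⟩) ≠ 0 := fun h0 => by
    have := hz ⟨0, hm⟩
    simp [hperp _ h0] at this
  refine ⟨?_, hc0⟩
  have h1 := hzero ⟨0, hm⟩
  rw [heq, crossIntensity_smul_self] at h1
  simp only [hc0, scaledIntensity, inner_zero_left] at h1
  have h2 : RCLike.re (inner 𝕜 e h) = 0 := by simpa [hze] using h1
  rw [heq, RCLike.ext (z := inner 𝕜 e h) (w := 0) (by simpa using h2) (by simpa using hh), zero_smul]

end Recovery

/-! ### Choice of constants and assembly -/

/-- The mesh parameter k is of order n², so the net has at most e^{O(n log n)} points; half of the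
Chernoff exponent cm pays for it when m ≥ (2Q/c) n log n. -/
theorem exists_sample_constants : ∃ c₀ γ s ε : ℝ, 0 < c₀ ∧ 0 < γ ∧ 0 ≤ s ∧ 0 < ε ∧
    ε ≤ tangentBound / 64 ∧ ε ≤ 1 / 24 ∧ s * truncLevel ≤ 1 / 64 ∧
    s * (truncLevel ^ 2 * 8192 * expMomentBound) ≤ ε / 2 ∧
    ∀ n m : ℕ, 2 ≤ n → c₀ * n * Real.log n ≤ m →
      ∃ k : ℕ, 0 < k ∧ 2 * n * truncLevel * (2 * (2 * n / k)) ≤ ε ∧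
        4 * ((2 * (k : ℝ) + 1) ^ (2 * n) * Real.exp (-(s * ε / 2 * m))) ≤
          3 * Real.exp (-γ * (m / n)) := by
  have hM := one_le_truncLevel
  have hK := two_le_expMomentBound
  have htb := tangentBound_pos
  set ε := min (tangentBound / 64) (1 / 24) with hε
  have hε0 : 0 < ε := by rw [hε]; positivity
  set C := truncLevel ^ 2 * 8192 * expMomentBound with hC
  have hC0 : 0 < C := by positivity
  set s := min (1 / (64 * truncLevel)) (ε / (2 * C)) with hs
  have hs0 : 0 < s := by rw [hs]; positivity
  set c := s * ε / 2 with hc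
  have hc0 : 0 < c := by positivity
  set B := 8 * truncLevel / ε + 1 with hB
  have hB0 : 1 ≤ B := by
    have : 0 ≤ 8 * truncLevel / ε := by positivity
    linarith
  have hlogB : 0 ≤ Real.log (2 * B + 1) := Real.log_nonneg (by linarith)
  have hlog2 : 0 < Real.log 2 := Real.log_pos (by norm_num)
  -- The 5 counts 4n log n from the powers of n² in the net size and n log n for the factor 4; log 2
  -- ≤ log n turns the remaining constant into a multiple of log n.
  set Q := 2 * Real.log (2 * B + 1) / Real.log 2 + 5 with hQ
  have hQ0 : 0 < Q := by positivity
  refine ⟨2 * Q / c, c / 2, s, ε, by positivity, by positivity, hs0.le, hε0, min_le_left _ _,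
    min_le_right _ _, ?_, ?_, fun n m hn hm => ?_⟩
  · calc s * truncLevel ≤ 1 / (64 * truncLevel) * truncLevel := by gcongr; exact min_le_left _ _
      _ = 1 / 64 := by field_simp
  · calc s * C ≤ ε / (2 * C) * C := by gcongr; exact min_le_right _ _
      _ = ε / 2 := by field_simp
  have hn' : (2 : ℝ) ≤ n := by exact_mod_cast hn
  have hn0 : (0 : ℝ) < n := by linarith
  have hlogn : Real.log 2 ≤ Real.log n := Real.log_le_log (by norm_num) hn'
  set r := 8 * truncLevel * n ^ 2 / ε with hr
  have hr0 : 0 < r := by positivity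
  have hk0 : 0 < ⌈r⌉₊ := Nat.ceil_pos.2 hr0
  have hrk : r ≤ ⌈r⌉₊ := Nat.le_ceil r
  have hkr : (⌈r⌉₊ : ℝ) < r + 1 := Nat.ceil_lt_add_one hr0.le
  refine ⟨⌈r⌉₊, hk0, ?_, ?_⟩
  · have : 2 * n * truncLevel * (2 * (2 * n / ⌈r⌉₊)) = 8 * truncLevel * n ^ 2 / ⌈r⌉₊ := by ring
    rw [this, div_le_iff₀ (by exact_mod_cast hk0)]
    rw [hr, div_le_iff₀ hε0] at hrk
    linarith
  have hkB : 2 * (⌈r⌉₊ : ℝ) + 1 ≤ (2 * B + 1) * n ^ 2 := by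
    have h1 : r = (B - 1) * n ^ 2 := by rw [hr, hB]; ring
    nlinarith
  have hexpB : (2 * B + 1) * (n : ℝ) ^ 2 = Real.exp (Real.log (2 * B + 1) + 2 * Real.log n) := by
    rw [Real.exp_add, Real.exp_log (by linarith), mul_comm 2 (Real.log n), Real.exp_mul,
      Real.exp_log hn0]
    norm_num
  have hpow : (2 * (⌈r⌉₊ : ℝ) + 1) ^ (2 * n) ≤
      Real.exp (2 * n * (Real.log (2 * B + 1) + 2 * Real.log n)) := by
    calc _ ≤ ((2 * B + 1) * (n : ℝ) ^ 2) ^ (2 * n) := by gcongr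
      _ = _ := by rw [hexpB, ← Real.exp_nat_mul]; push_cast; rfl
  have h4 : (4 : ℝ) ≤ Real.exp (n * Real.log n) := by
    have h41 : (4 : ℝ) = Real.exp (2 * Real.log 2) := by
      rw [mul_comm, Real.exp_mul, Real.exp_log (by norm_num)]; norm_num
    rw [h41, Real.exp_le_exp]
    gcongr
  have hexponent : n * Real.log n + (2 * n * (Real.log (2 * B + 1) + 2 * Real.log n) +
      -(c * m)) ≤ -(c / 2) * (m / n) := by
    have h1 : Real.log (2 * B + 1) ≤ Real.log (2 * B + 1) / Real.log 2 * Real.log n := by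
      rw [div_mul_eq_mul_div, le_div_iff₀ hlog2]
      gcongr
    have h2 : n * Real.log n + 2 * n * (Real.log (2 * B + 1) + 2 * Real.log n) ≤
        Q * (n * Real.log n) := by
      have h3 := mul_le_mul_of_nonneg_left h1 (by positivity : (0 : ℝ) ≤ 2 * n)
      have h5 : Q * (n * Real.log n) =
          2 * n * (Real.log (2 * B + 1) / Real.log 2 * Real.log n) + 5 * (n * Real.log n) := by
        rw [hQ]; ring
      linarith
    have h6 : Q * (n * Real.log n) ≤ c / 2 * m := by
      have h7 := mul_le_mul_of_nonneg_left hm (by positivity : 0 ≤ c / 2)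
      refine le_trans (le_of_eq ?_) h7
      field_simp
    -- The rate obtained is linear in m; it is weakened to m/n only here.
    have h8 : c / 2 * (m / n) ≤ c / 2 * m := by
      gcongr
      exact div_le_self (by positivity) (by linarith)
    linarith
  calc _ ≤ Real.exp (n * Real.log n) *
      (Real.exp (2 * n * (Real.log (2 * B + 1) + 2 * Real.log n)) * Real.exp (-(c * m))) := by
        gcongr
    _ = Real.exp (n * Real.log n + (2 * n * (Real.log (2 * B + 1) + 2 * Real.log n) +
      -(c * m))) := by rw [Real.exp_add, Real.exp_add]
    _ ≤ Real.exp (-(c / 2) * (m / n)) := Real.exp_le_exp.2 hexponent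
    _ ≤ _ := by linarith [Real.exp_pos (-(c / 2) * (m / n))]

theorem exists_measurableSet_tangentInjective {𝕜 E : Type*} [RCLike 𝕜] [NormedAddCommGroup E]
    [InnerProductSpace 𝕜 E] [InnerProductSpace ℝ E] [FiniteDimensional ℝ E] [MeasurableSpace E]
    [BorelSpace E] [IsScalarTower ℝ 𝕜 E] {n m : ℕ} (h : IsRealification 𝕜 E n) (hn : 2 ≤ n)
    (hm : 0 < m) {s ε δ : ℝ} (hs : 0 ≤ s) (hε : 0 < ε) (hε1 : ε ≤ tangentBound / 64)
    (hε2 : ε ≤ 1 / 24) (hsM : s * truncLevel ≤ 1 / 64)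
    (hsK : s * (truncLevel ^ 2 * 8192 * expMomentBound) ≤ ε / 2) {k : ℕ} (hk : 0 < k)
    (hkε : 2 * n * truncLevel * (2 * (2 * n / k)) ≤ ε)
    (hδ : 4 * ((2 * (k : ℝ) + 1) ^ (2 * n) * Real.exp (-(s * ε / 2 * m))) ≤ δ)
    {Ω : Type*} [MeasurableSpace Ω] {P : Measure Ω} [IsProbabilityMeasure P]
    {z : Fin m → Ω → Metric.sphere (0 : E) 1} (hind : iIndepFun z P)
    (hlaw : ∀ i, HasLaw (z i) (uniformSphere E) P) {e : E} (he : ‖e‖ = 1) :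
    ∃ S : Set Ω, MeasurableSet S ∧ 1 - δ ≤ P.real S ∧
      ∀ ω ∈ S, TangentInjective 𝕜 n e (fun i => (z i ω : E)) := by
  have : Nontrivial E := ⟨e, 0, norm_ne_zero_iff.1 (by rw [he]; exact one_ne_zero)⟩
  have hbad := (measure_not_isGoodSample_le h hn hind hlaw he hs hsM hsK hk hkε).trans hδ
  set bad := {ω | ¬ IsGoodSample 𝕜 n ε e (fun i => (z i ω : E))}
  -- The bad event involves uncountably many directions; passing to a measurable hull of equal
  -- measure avoids proving it measurable.
  refine ⟨(toMeasurable P bad)ᶜ, (measurableSet_toMeasurable P bad).compl, ?_, fun ω hω => ?_⟩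
  · rw [probReal_compl_eq_one_sub (measurableSet_toMeasurable P bad), measureReal_def,
      measure_toMeasurable, ← measureReal_def]
    linarith
  · have hgood : IsGoodSample 𝕜 n ε e (fun i => (z i ω : E)) := by
      by_contra hcon
      exact hω (subset_toMeasurable P bad hcon)
    exact fun v c hv hc hzero =>
      hgood.eq_zero_of_measurements_eq_zero hm hε hε1 hε2 hv hc hzero

theorem exists_measurableSet_exactRecovery {𝕜 : Type*} [RCLike 𝕜] {n m : ℕ} (hn : 1 ≤ n) {γ : ℝ}
    (x : EuclideanSpace 𝕜 (Fin n)) {Ω : Type*} [MeasurableSpace Ω] (P : Measure Ω)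
    [IsProbabilityMeasure P] (z : Fin m → Ω → Metric.sphere (0 : EuclideanSpace 𝕜 (Fin n)) 1)
    (hinj : 2 ≤ n → 0 < m → ∀ e : EuclideanSpace 𝕜 (Fin n), ‖e‖ = 1 →
      ∃ S : Set Ω, MeasurableSet S ∧ 1 - 3 * Real.exp (-γ * (m / n)) ≤ P.real S ∧
        ∀ ω ∈ S, TangentInjective 𝕜 n e (fun i => (z i ω : EuclideanSpace 𝕜 (Fin n)))) :
    ∃ S : Set Ω, MeasurableSet S ∧ 1 - 3 * Real.exp (-γ * (m / n)) ≤ P.real S ∧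
      ∀ ω ∈ S, ExactRecovery (fun i => (z i ω : EuclideanSpace 𝕜 (Fin n))) x := by
  rcases Nat.eq_zero_or_pos m with rfl | hm
  -- For m = 0 the claimed probability is 1 − 3 < 0.
  · exact ⟨∅, MeasurableSet.empty, by simp, by simp⟩
  have : NeZero n := ⟨by omega⟩
  obtain ⟨e, he, hx⟩ := exists_norm_eq_one_eq_norm_smul x
  rcases hn.eq_or_lt with rfl | hn2
  · refine ⟨Set.univ, MeasurableSet.univ, ?_, fun ω _ => (tangentInjective_of_dimension_one hm he
      fun i => norm_eq_of_mem_sphere (z i ω)).exactRecovery he hx⟩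
    rw [probReal_univ]
    linarith [Real.exp_pos (-γ * (m / (1 : ℕ)))]
  · obtain ⟨S, hS, hP, hSinj⟩ := hinj hn2 hm e he
    exact ⟨S, hS, hP, fun ω hω => (hSinj ω hω).exactRecovery he hx⟩

theorem isRealification_real (n : ℕ) : IsRealification ℝ (EuclideanSpace ℝ (Fin n)) n :=
  ⟨fun _ _ => rfl, Or.inl ⟨RCLike.I_to_real, by simp⟩⟩

theorem isRealification_complex (n : ℕ) : IsRealification ℂ (EuclideanSpace ℂ (Fin n)) n := by
  refine ⟨fun x y => by simp [PiLp.inner_apply], Or.inr ⟨by simp, ?_⟩⟩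
  rw [← Module.finrank_mul_finrank ℝ ℂ (EuclideanSpace ℂ (Fin n))]
  simp

end PhaseLift

theorem theorem1 :
    ∃ c₀ γ : ℝ, 0 < c₀ ∧ 0 < γ ∧
      ∀ n m : ℕ, 1 ≤ n → c₀ * n * Real.log n ≤ m →
        -- the real-valued model
        (∀ (x : EuclideanSpace ℝ (Fin n))
          (Ω : Type*) [MeasurableSpace Ω] (P : Measure Ω) [IsProbabilityMeasure P]
          (z : Fin m → Ω → Metric.sphere (0 : EuclideanSpace ℝ (Fin n)) 1),
          iIndepFun z P →
          (∀ i, HasLaw (z i) (PhaseLift.uniformSphere (EuclideanSpace ℝ (Fin n))) P) →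
          ∃ S : Set Ω, MeasurableSet S ∧
            1 - 3 * Real.exp (-γ * (m / n)) ≤ P.real S ∧
            ∀ ω ∈ S, PhaseLift.ExactRecovery (fun i => (z i ω : EuclideanSpace ℝ (Fin n))) x) ∧
        -- the complex-valued model
        (∀ (x : EuclideanSpace ℂ (Fin n))
          (Ω : Type*) [MeasurableSpace Ω] (P : Measure Ω) [IsProbabilityMeasure P]
          (z : Fin m → Ω → Metric.sphere (0 : EuclideanSpace ℂ (Fin n)) 1),
          iIndepFun z P →
          (∀ i, HasLaw (z i) (PhaseLift.uniformSphere (EuclideanSpace ℂ (Fin n))) P) →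
          ∃ S : Set Ω, MeasurableSet S ∧
            1 - 3 * Real.exp (-γ * (m / n)) ≤ P.real S ∧
            ∀ ω ∈ S, PhaseLift.ExactRecovery (fun i => (z i ω : EuclideanSpace ℂ (Fin n))) x) := by
  obtain ⟨c₀, γ, s, ε, hc₀, hγ, hs, hε, hε1, hε2, hsM, hsK, hk⟩ :=
    PhaseLift.exists_sample_constants
  refine ⟨c₀, γ, hc₀, hγ, fun n m hn hm => ⟨?_, ?_⟩⟩
  · intro x Ω _ P _ z hind hlaw
    refine PhaseLift.exists_measurableSet_exactRecovery hn x P z fun hn2 hm0 e he => ?_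
    obtain ⟨k, hk0, hkε, hδ⟩ := hk n m hn2 hm
    exact PhaseLift.exists_measurableSet_tangentInjective (PhaseLift.isRealification_real n) hn2
      hm0 hs hε hε1 hε2 hsM hsK hk0 hkε hδ hind hlaw he
  · intro x Ω _ P _ z hind hlaw
    refine PhaseLift.exists_measurableSet_exactRecovery hn x P z fun hn2 hm0 e he => ?_
    obtain ⟨k, hk0, hkε, hδ⟩ := hk n m hn2 hm
    exact PhaseLift.exists_measurableSet_tangentInjective (PhaseLift.isRealification_complex n) hn2
      hm0 hs hε hε1 hε2 hsM hsK hk0 hkε hδ hind hlaw he
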